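/- Let $n$ be a positive integer, let $\Sigma$ be the set of primes not dividing $n!$, and let $\mathbb{Z}^{\Sigma}$ denote the pro-$\Sigma$ completion of $\mathbb{Z}$ (a topological ring). Let $\pi$ be the pro-$\Sigma$ completion of the free group on $\gamma_1,\dots,\gamma_r$, and let $\pi=[\pi]_1\supseteq[\pi]_2\supseteq\cdots$ be its lower central series, where $[\pi]_{k+1}$ is the closure of the subgroup generated by the commutators of elements of $\pi$ with elements of $[\pi]_k$. Let $G$ be a profinite group, let $\chi:G\to(\mathbb{Z}^{\Sigma})^{*}$ be a continuous character, and let $G$ act continuously on $\pi$ by $g\gamma_i=\gamma_i^{\chi(g)}$. Write $\mathbb{Z}^{\Sigma}(\chi^k)$ for $\mathbb{Z}^{\Sigma}$ with $g\in G$ acting as multiplication by $\chi(g)^k$. All cochains are continuous and inhomogeneous, $D$ denotes their coboundary, and $(c\cup d)(g,h)=c(g)\cdot g\,d(h)$ for $1$-cochains $c$, $d$ with values in $\mathbb{Z}^{\Sigma}(\chi^k)$, $\mathbb{Z}^{\Sigma}(\chi^l)$. Let $$\delta_n:H^1(G,\pi/[\pi]_n)\to H^2(G,[\pi]_n/[\pi]_{n+1})$$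 be the boundary map of the central extension $1\to[\pi]_n/[\pi]_{n+1}\to\pi/[\pi]_{n+1}\to\pi/[\pi]_n\to1$: it sends the class of a cocycle $x$ to the class of $(g,h)\mapsto \tilde x(g)\,g\tilde x(h)\,\tilde x(gh)^{-1}$, where $\tilde x:G\to\pi/[\pi]_{n+1}$ is any continuous lift of $x$. Let $U_{n+1}$ be the group of upper triangular $(n+1)\times(n+1)$ matrices over $\mathbb{Z}^{\Sigma}$ with diagonal entries $1$, let $a_{i,j}$ be the $(i,j)$-entry, and let $\overline U_{n+1}$ be the quotient of $U_{n+1}$ by the subgroup of matrices whose only non-zero off-diagonal entry is $a_{1,n+1}$. For $J:\{1,\dots,n\}\to\{1,\dots,r\}$ let $\varphi_J:\pi\to U_{n+1}$ be the continuous homomorphism with $a_{i,i}\varphi_J(\gamma_k)=1$, with $a_{i,j}\varphi_J(\gamma_k)=\frac1{(j-i)!}$ if $i<j$ and $J(v)=k$ for all $i\le v<j$, and with all other entries $0$; it induces a homomorphism $\varphi_J:\pi/[\pi]_n\to\overline U_{n+1}$. Let $x:G\to\pi/[\pi]_n$ be a continuous cocycle, and (for $n\ge2$) let $x_1\oplus\cdots\oplus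 x_r\in H^1(G,\mathbb{Z}^{\Sigma}(\chi))^r$ be the image of $[x]$ under $\pi/[\pi]_n\to\pi/[\pi]_2\cong\mathbb{Z}^{\Sigma}(\chi)^r$, where the isomorphism is given by the basis $\gamma_1,\dots,\gamma_r$. Then for every $J$ the cochains $T_{i,j}=-a_{i,j}\varphi_J x$, $1\le i<j\le n+1$, $(i,j)\ne(1,n+1)$, form a defining system for the Massey product $\langle -x_{J(1)},\dots,-x_{J(n)}\rangle$, that is, $T_{i,i+1}$ represents $-x_{J(i)}$ and $DT_{i,j}=\sum_{p=i+1}^{j-1}T_{i,p}\cup T_{p,j}$ for $i+1<j$; and $\delta_n([x])=0$ if and only if, for every $J:\{1,\dots,n\}\to\{1,\dots,r\}$, the Massey product $$\langle -x_{J(1)},\dots,-x_{J(n)}\rangle=\Big[\sum_{p=2}^{n}T_{1,p}\cup T_{p,n+1}\Big]\in H^2(G,\mathbb{Z}^{\Sigma}(\chi^n))$$ taken with respect to this defining system vanishes. -/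

import Mathlib

namespace DeltaMassey

/-! ### Pro-`S` completions -/

/-- `m` is a product of powers of primes in `S`. -/
def IsSigmaNumber (S : Set ℕ) (m : ℕ) : Prop :=
  m ≠ 0 ∧ ∀ p : ℕ, p.Prime → p ∣ m → p ∈ S

theorem IsSigmaNumber.of_dvd {S : Set ℕ} {m k : ℕ} (h : IsSigmaNumber S m) (hk : k ∣ m) :
    IsSigmaNumber S k :=
  ⟨fun h0 => h.1 (by simpa [h0] using hk), fun p hp hpk => h.2 p hp (hpk.trans hk)⟩

theorem IsSigmaNumber.mul {S : Set ℕ} {m k : ℕ} (h : IsSigmaNumber S m)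
    (hk : IsSigmaNumber S k) : IsSigmaNumber S (m * k) :=
  ⟨mul_ne_zero h.1 hk.1, fun p hp hd => (hp.dvd_mul.1 hd).elim (h.2 p hp) (hk.2 p hp)⟩

/-- The ring `ℤ^S`, the pro-`S` completion of `ℤ`: the inverse limit of the rings `ℤ/m`, where
`m` runs over the products of powers of primes in `S`. -/
def ZSigma (S : Set ℕ) : Subring (∀ m : {m : ℕ // IsSigmaNumber S m}, ZMod m.1) where
  carrier := {a | ∀ (m m' : {m : ℕ // IsSigmaNumber S m}) (h : m.1 ∣ m'.1),
    ZMod.castHom h (ZMod m.1) (a m') = a m}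
  mul_mem' ha hb m m' h := by
    rw [Pi.mul_apply, Pi.mul_apply, map_mul, ha m m' h, hb m m' h]
  one_mem' m m' h := by rw [Pi.one_apply, Pi.one_apply, map_one]
  add_mem' ha hb m m' h := by
    rw [Pi.add_apply, Pi.add_apply, map_add, ha m m' h, hb m m' h]
  zero_mem' m m' h := by rw [Pi.zero_apply, Pi.zero_apply, map_zero]
  neg_mem' ha m m' h := by rw [Pi.neg_apply, Pi.neg_apply, map_neg, ha m m' h]

/-- A normal subgroup of `F` whose index is a product of powers of primes in `S`. -/
def SigmaSubgroup (S : Set ℕ) (F : Type*) [Group F] : Type _ :=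
  {N : Subgroup F // N.Normal ∧ IsSigmaNumber S N.index}

section Completion

variable {S : Set ℕ} {F : Type*} [Group F]

instance (N : SigmaSubgroup S F) : N.1.Normal := N.2.1

/-- The finite quotient `F/N`, with the discrete topology. -/
def FinQuot (N : SigmaSubgroup S F) : Type _ := F ⧸ N.1

instance (N : SigmaSubgroup S F) : Group (FinQuot N) :=
  inferInstanceAs (Group (F ⧸ N.1))

instance (N : SigmaSubgroup S F) : TopologicalSpace (FinQuot N) := ⊥

instance (N : SigmaSubgroup S F) : DiscreteTopology (FinQuot N) := ⟨rfl⟩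

instance (N : SigmaSubgroup S F) : Finite (FinQuot N) := by
  have : N.1.FiniteIndex := ⟨N.2.2.1⟩
  exact inferInstanceAs (Finite (F ⧸ N.1))

/-- The quotient map `F → F/N`. -/
def FinQuot.mk (N : SigmaSubgroup S F) : F →* FinQuot N := QuotientGroup.mk' N.1

/-- The transition map `F/N → F/M` for `N ≤ M`. -/
def FinQuot.map {N M : SigmaSubgroup S F} (h : N.1 ≤ M.1) : FinQuot N →* FinQuot M :=
  QuotientGroup.map N.1 M.1 (MonoidHom.id F) h

theorem FinQuot.mk_surjective (N : SigmaSubgroup S F) : Function.Surjective (FinQuot.mk N) :=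
  QuotientGroup.mk'_surjective N.1

theorem FinQuot.map_mk {N M : SigmaSubgroup S F} (h : N.1 ≤ M.1) (y : F) :
    FinQuot.map h (FinQuot.mk N y) = FinQuot.mk M y := rfl

theorem FinQuot.mk_eq_iff (N : SigmaSubgroup S F) (x y : F) :
    FinQuot.mk N x = FinQuot.mk N y ↔ x⁻¹ * y ∈ N.1 := QuotientGroup.eq

theorem FinQuot.pow_index (N : SigmaSubgroup S F) (q : FinQuot N) : q ^ N.1.index = 1 :=
  pow_card_eq_one' (G := F ⧸ N.1) (x := q)

variable (S F) in
/-- The pro-`S` completion of `F`: the inverse limit of the quotients of `F` whose order is a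
product of powers of primes in `S`. -/
def proCompletion : Subgroup (∀ N : SigmaSubgroup S F, FinQuot N) where
  carrier := {w | ∀ (N M : SigmaSubgroup S F) (h : N.1 ≤ M.1), FinQuot.map h (w N) = w M}
  mul_mem' ha hb N M h := by
    rw [Pi.mul_apply, Pi.mul_apply, map_mul, ha N M h, hb N M h]
  one_mem' N M h := by rw [Pi.one_apply, Pi.one_apply, map_one]
  inv_mem' ha N M h := by rw [Pi.inv_apply, Pi.inv_apply, map_inv, ha N M h]

/-- The canonical map from `F` to its pro-`S` completion. -/
def toCompletion : F →* proCompletion S F where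
  toFun y := ⟨fun N => FinQuot.mk N y, fun _ _ _ => rfl⟩
  map_one' := Subtype.ext (funext fun _ => map_one _)
  map_mul' x y := Subtype.ext (funext fun _ => map_mul _ x y)

instance : CompactSpace (proCompletion S F) := by
  refine isCompact_iff_compactSpace.1 (IsClosed.isCompact ?_)
  have : ((proCompletion S F : Subgroup _) : Set (∀ N : SigmaSubgroup S F, FinQuot N)) =
      ⋂ (N : SigmaSubgroup S F), ⋂ (M : SigmaSubgroup S F), ⋂ (h : N.1 ≤ M.1),
        {w | FinQuot.map h (w N) = w M} := by
    ext w; simp only [Set.mem_iInter]; rfl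
  rw [this]
  refine isClosed_iInter fun N => isClosed_iInter fun M => isClosed_iInter fun h => ?_
  exact isClosed_eq (continuous_of_discreteTopology.comp (continuous_apply N))
    (continuous_apply M)

instance : TotallyDisconnectedSpace (proCompletion S F) :=
  Subtype.totallyDisconnectedSpace

theorem SigmaSubgroup.isSigma_inf (N M : SigmaSubgroup S F) :
    IsSigmaNumber S (N.1 ⊓ M.1).index := by
  have h := Subgroup.relIndex_mul_index (H := N.1 ⊓ M.1) (K := M.1) inf_le_right
  rw [Subgroup.inf_relIndex_right] at h
  rw [← h]
  exact IsSigmaNumber.mul (N.2.2.of_dvd (Subgroup.relIndex_dvd_index_of_normal N.1 M.1)) M.2.2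

theorem exists_approx (w : proCompletion S F) (N M : SigmaSubgroup S F) :
    ∃ y : F, w.1 N = FinQuot.mk N y ∧ w.1 M = FinQuot.mk M y := by
  let P : SigmaSubgroup S F := ⟨N.1 ⊓ M.1, inferInstance, N.isSigma_inf M⟩
  obtain ⟨y, hy⟩ := FinQuot.mk_surjective P (w.1 P)
  refine ⟨y, ?_, ?_⟩
  · rw [← w.2 P N inf_le_left, ← hy, FinQuot.map_mk]
  · rw [← w.2 P M inf_le_right, ← hy, FinQuot.map_mk]

/-! ### The universal property of the pro-`S` completion -/

/-- A presentation of the group `H` as an inverse limit of finite groups `H/K_a` whose orders are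
products of powers of primes in `S`. -/
structure SigmaLimit (S : Set ℕ) (H : Type*) [Group H] where
  ι : Type*
  K : ι → Subgroup H
  normal : ∀ a, (K a).Normal
  isSigma : ∀ a, IsSigmaNumber S (K a).index
  separated : ∀ x, (∀ a, x ∈ K a) → x = 1
  complete : ∀ h : ι → H,
    (∀ a b, ∃ x, (h a)⁻¹ * x ∈ K a ∧ (h b)⁻¹ * x ∈ K b) → ∃ x, ∀ a, (h a)⁻¹ * x ∈ K a

variable {H : Type*} [Group H]

/-- The preimage under `f : F → H` of the normal subgroup `K_a` of `H`. -/
def SigmaLimit.pull (L : SigmaLimit S H) (f : F →* H) (a : L.ι) : SigmaSubgroup S F :=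
  ⟨(L.K a).comap f, (L.normal a).comap f, (L.isSigma a).of_dvd (by
    rw [Subgroup.index_comap]
    have := L.normal a
    exact Subgroup.relIndex_dvd_index_of_normal _ _)⟩

theorem SigmaLimit.exists_ext (L : SigmaLimit S H) (f : F →* H) (w : proCompletion S F) :
    ∃ x : H, ∀ (a : L.ι) (y : F), w.1 (L.pull f a) = FinQuot.mk _ y → (f y)⁻¹ * x ∈ L.K a := by
  choose y hy using fun a => FinQuot.mk_surjective (L.pull f a) (w.1 (L.pull f a))
  obtain ⟨x, hx⟩ := L.complete (fun a => f (y a)) (fun a b => by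
    obtain ⟨z, hz, hz'⟩ := exists_approx w (L.pull f a) (L.pull f b)
    rw [← hy, FinQuot.mk_eq_iff] at hz hz'
    refine ⟨f z, ?_, ?_⟩
    · simpa [SigmaLimit.pull] using hz
    · simpa [SigmaLimit.pull] using hz')
  refine ⟨x, fun a z hz => ?_⟩
  rw [← hy, eq_comm, FinQuot.mk_eq_iff] at hz
  have h1 : (f z)⁻¹ * f (y a) ∈ L.K a := by simpa [SigmaLimit.pull] using hz
  simpa [mul_assoc] using mul_mem h1 (hx a)

theorem SigmaLimit.eq_of (L : SigmaLimit S H) {x x' : H} (h : ∀ a, x⁻¹ * x' ∈ L.K a) : x = x' :=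
  inv_mul_eq_one.1 (L.separated _ h)

/-- The unique extension of `f : F → H` to a continuous homomorphism from the pro-`S`
completion of `F` to `H`. -/
noncomputable def SigmaLimit.ext (L : SigmaLimit S H) (f : F →* H) : proCompletion S F →* H :=
  MonoidHom.mk' (fun w => (L.exists_ext f w).choose) (fun v w => by
    refine L.eq_of fun a => ?_
    have := L.normal a
    have h1 := (L.exists_ext f v).choose_spec a
    have h2 := (L.exists_ext f w).choose_spec a
    have h3 := (L.exists_ext f (v * w)).choose_spec a
    obtain ⟨y, hy⟩ := FinQuot.mk_surjective _ (v.1 (L.pull f a))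
    obtain ⟨z, hz⟩ := FinQuot.mk_surjective _ (w.1 (L.pull f a))
    replace h1 := h1 y hy.symm
    replace h2 := h2 z hz.symm
    replace h3 := h3 (y * z) (by rw [map_mul, hy, hz]; rfl)
    rw [← QuotientGroup.eq] at h1 h2 h3 ⊢
    rw [← h3, QuotientGroup.mk_mul, ← h1, ← h2, map_mul, QuotientGroup.mk_mul])

theorem SigmaLimit.ext_spec (L : SigmaLimit S H) (f : F →* H) (w : proCompletion S F) (a : L.ι)
    (y : F) (h : w.1 (L.pull f a) = FinQuot.mk _ y) : (f y)⁻¹ * L.ext f w ∈ L.K a :=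
  (L.exists_ext f w).choose_spec a y h

theorem SigmaLimit.ext_toCompletion (L : SigmaLimit S H) (f : F →* H) (y : F) :
    L.ext f (toCompletion y) = f y :=
  (L.eq_of fun a => L.ext_spec f _ a y rfl).symm

theorem SigmaLimit.isOpen_ext (L : SigmaLimit S H) (f : F →* H) (w : proCompletion S F)
    (a : L.ι) : ∀ᶠ v in nhds w, (L.ext f w)⁻¹ * L.ext f v ∈ L.K a := by
  have hc : Continuous fun v : proCompletion S F => v.1 (L.pull f a) :=
    (continuous_apply _).comp continuous_subtype_val
  have : ∀ᶠ v in nhds w, v.1 (L.pull f a) = w.1 (L.pull f a) :=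
    hc.continuousAt.eventually (isOpen_discrete {w.1 (L.pull f a)} |>.mem_nhds rfl)
  filter_upwards [this] with v hv
  obtain ⟨y, hy⟩ := FinQuot.mk_surjective _ (w.1 (L.pull f a))
  have h1 := L.ext_spec f w a y hy.symm
  have h2 := L.ext_spec f v a y (hv.trans hy.symm)
  simpa [mul_assoc] using mul_mem (inv_mem h1) h2

/-- The pro-`S` completion of `F`, presented by the kernels of the projections to `F/N`. -/
def limitCompletion (S : Set ℕ) (F : Type*) [Group F] : SigmaLimit S (proCompletion S F) where
  ι := SigmaSubgroup S F
  K N := ((Pi.evalMonoidHom _ N).comp (proCompletion S F).subtype).ker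
  normal _ := inferInstance
  isSigma N := by
    refine N.2.2.of_dvd ?_
    rw [Subgroup.index_ker]
    exact Subgroup.card_subgroup_dvd_card (α := FinQuot N) _
  separated x hx := Subtype.ext (funext hx)
  complete h hh := by
    have key : ∀ (a : SigmaSubgroup S F) (x y : proCompletion S F),
        x⁻¹ * y ∈ ((Pi.evalMonoidHom _ a).comp (proCompletion S F).subtype).ker ↔
          x.1 a = y.1 a := by
      intro a x y
      rw [MonoidHom.mem_ker, map_mul, map_inv, inv_mul_eq_one]; rfl
    simp only [key] at hh ⊢
    refine ⟨⟨fun N => (h N).1 N, fun N M hNM => ?_⟩, fun _ => rfl⟩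
    obtain ⟨x, h1, h2⟩ := hh N M
    exact (congrArg _ h1).trans ((x.2 N M hNM).trans h2.symm)

/-- The additive group `ℤ^S`, presented by the kernels of the projections to `ℤ/m`. -/
def limitZSigma (S : Set ℕ) : SigmaLimit S (Multiplicative (ZSigma S)) where
  ι := {m : ℕ // IsSigmaNumber S m}
  K m := (AddMonoidHom.toMultiplicative
    ((Pi.evalAddMonoidHom _ m).comp (ZSigma S).subtype.toAddMonoidHom)).ker
  normal _ := inferInstance
  isSigma m := by
    refine m.2.of_dvd ?_
    rw [Subgroup.index_ker]
    have h := Subgroup.card_subgroup_dvd_card (α := Multiplicative (ZMod m.1))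
      (AddMonoidHom.toMultiplicative
        ((Pi.evalAddMonoidHom _ m).comp (ZSigma S).subtype.toAddMonoidHom)).range
    rwa [show Nat.card (Multiplicative (ZMod m.1)) = m.1 from Nat.card_zmod m.1] at h
  separated x hx := Subtype.ext (funext hx)
  complete h hh := by
    have key : ∀ (a : {m : ℕ // IsSigmaNumber S m}) (x y : Multiplicative (ZSigma S)),
        x⁻¹ * y ∈ (AddMonoidHom.toMultiplicative
          ((Pi.evalAddMonoidHom _ a).comp (ZSigma S).subtype.toAddMonoidHom)).ker ↔
          x.toAdd.1 a = y.toAdd.1 a := by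
      intro a x y
      rw [MonoidHom.mem_ker, map_mul, map_inv, inv_mul_eq_one]; rfl
    simp only [key] at hh ⊢
    refine ⟨Multiplicative.ofAdd ⟨fun m => (h m).toAdd.1 m, fun m m' hm => ?_⟩, fun _ => rfl⟩
    obtain ⟨x, h1, h2⟩ := hh m m'
    exact (congrArg _ h2).trans ((x.toAdd.2 m m' hm).trans h1.symm)

/-- The condition that a homomorphism from the completion to `H` is continuous, for the
inverse limit topology on `H`. -/
def SigmaLimit.Cont (L : SigmaLimit S H) (θ : proCompletion S F →* H) : Prop :=
  ∀ a : L.ι, ∃ N : SigmaSubgroup S F, ∀ w, w.1 N = 1 → θ w ∈ L.K a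

theorem SigmaLimit.cont_ext (L : SigmaLimit S H) (f : F →* H) : L.Cont (L.ext f) :=
  fun a => ⟨L.pull f a, fun w hw => by
    simpa using L.ext_spec f w a 1 (hw.trans (map_one _).symm)⟩

theorem SigmaLimit.Cont.comp {L : SigmaLimit S H} {θ : proCompletion S F →* H} (hθ : L.Cont θ)
    {F' : Type*} [Group F'] {η : proCompletion S F' →* proCompletion S F}
    (hη : (limitCompletion S F).Cont η) : L.Cont (θ.comp η) := fun a => by
  obtain ⟨N, hN⟩ := hθ a
  obtain ⟨M, hM⟩ := hη N
  exact ⟨M, fun w hw => hN _ (hM w hw)⟩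

theorem SigmaLimit.ext_unique (L : SigmaLimit S H) (f : F →* H) (θ : proCompletion S F →* H)
    (hθ : L.Cont θ) (h : ∀ y, θ (toCompletion y) = f y) : θ = L.ext f := by
  ext w
  refine L.eq_of fun a => ?_
  obtain ⟨N, hN⟩ := hθ a
  obtain ⟨y, h1, h2⟩ := exists_approx w N (L.pull f a)
  have h3 := L.ext_spec f w a y h2
  have h4 := hN (w⁻¹ * toCompletion y) (by
    change (w.1 N)⁻¹ * FinQuot.mk N y = 1
    rw [h1, inv_mul_cancel])
  rw [map_mul, h, map_inv] at h4
  simpa [mul_assoc] using mul_mem h4 h3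

theorem exists_nat_approx (u : ZSigma S) (m m' : {m : ℕ // IsSigmaNumber S m}) :
    ∃ e : ℕ, (e : ZMod m.1) = u.1 m ∧ (e : ZMod m'.1) = u.1 m' := by
  let k : {m : ℕ // IsSigmaNumber S m} := ⟨m.1 * m'.1, m.2.mul m'.2⟩
  have : NeZero k.1 := ⟨k.2.1⟩
  have hk : (((u.1 k).val : ℕ) : ZMod k.1) = u.1 k := ZMod.natCast_zmod_val _
  refine ⟨(u.1 k).val, ?_, ?_⟩
  · rw [← u.2 m k (Dvd.intro _ rfl)]
    conv_rhs => rw [← hk, map_natCast]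
  · rw [← u.2 m' k (Dvd.intro_left _ rfl)]
    conv_rhs => rw [← hk, map_natCast]

theorem FinQuot.pow_eq (N : SigmaSubgroup S F) (q : FinQuot N) {e e' : ℕ}
    (h : (e : ZMod N.1.index) = e') : q ^ e = q ^ e' := by
  rw [ZMod.natCast_eq_natCast_iff] at h
  exact pow_eq_pow_of_modEq h (FinQuot.pow_index N q)

/-- The power `w ^ u` of an element `w` of a pro-`S` completion with exponent `u ∈ ℤ^S`. -/
noncomputable def spow (w : proCompletion S F) (u : ZSigma S) : proCompletion S F :=
  ⟨fun N => w.1 N ^ (u.1 ⟨N.1.index, N.2.2⟩).val, fun N M h => by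
    have : NeZero N.1.index := ⟨N.2.2.1⟩
    have : NeZero M.1.index := ⟨M.2.2.1⟩
    rw [map_pow, w.2 N M h]
    apply FinQuot.pow_eq
    have hu := u.2 ⟨M.1.index, M.2.2⟩ ⟨N.1.index, N.2.2⟩ (Subgroup.index_dvd_of_le h)
    rw [ZMod.natCast_zmod_val, ← hu]
    conv_rhs => rw [← ZMod.natCast_zmod_val (u.1 ⟨N.1.index, N.2.2⟩), map_natCast]⟩

theorem spow_apply (w : proCompletion S F) (u : ZSigma S) (N : SigmaSubgroup S F) (e : ℕ)
    (he : (e : ZMod N.1.index) = u.1 ⟨N.1.index, N.2.2⟩) : (spow w u).1 N = w.1 N ^ e := by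
  have : NeZero N.1.index := ⟨N.2.2.1⟩
  exact FinQuot.pow_eq N _ (by rw [ZMod.natCast_zmod_val, he])

theorem spow_one (w : proCompletion S F) : spow w (1 : ZSigma S) = w := by
  refine Subtype.ext (funext fun N => ?_)
  rw [spow_apply w 1 N 1 (by simp), pow_one]

theorem spow_mul (w : proCompletion S F) (u v : ZSigma S) :
    spow w (u * v) = spow (spow w u) v := by
  refine Subtype.ext (funext fun N => ?_)
  obtain ⟨e, he, -⟩ := exists_nat_approx u ⟨N.1.index, N.2.2⟩ ⟨N.1.index, N.2.2⟩
  obtain ⟨d, hd, -⟩ := exists_nat_approx v ⟨N.1.index, N.2.2⟩ ⟨N.1.index, N.2.2⟩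
  rw [spow_apply _ v N d hd, spow_apply w u N e he, ← pow_mul, spow_apply w (u * v) N (e * d)]
  push_cast
  rw [he, hd]; rfl

theorem SigmaLimit.Cont.map_spow {L : SigmaLimit S H} {θ : proCompletion S F →* H}
    (hθ : L.Cont θ) (w : proCompletion S F) (u : ZSigma S) (a : L.ι)
    (m : {m : ℕ // IsSigmaNumber S m}) :
    ∃ e : ℕ, (e : ZMod m.1) = u.1 m ∧ (θ w ^ e)⁻¹ * θ (spow w u) ∈ L.K a := by
  obtain ⟨N, hN⟩ := hθ a
  obtain ⟨e, he, he'⟩ := exists_nat_approx u m ⟨N.1.index, N.2.2⟩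
  refine ⟨e, he, ?_⟩
  rw [← map_pow, ← map_inv, ← map_mul]
  apply hN
  change (w.1 N ^ e)⁻¹ * (spow w u).1 N = 1
  rw [spow_apply w u N e he', inv_mul_cancel]

/-! ### The free pro-`S` group and the action through a character -/

/-- The pro-`S` completion of the free group on `r` generators. -/
abbrev FreePro (S : Set ℕ) (r : ℕ) : Type := proCompletion S (FreeGroup (Fin r))

/-- The generators `γ_i`. -/
def gen {r : ℕ} (i : Fin r) : FreePro S r := toCompletion (FreeGroup.of i)

/-- The homomorphism from the free group that sends `γ_i` to `γ_i ^ u`. -/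
noncomputable def freePow (r : ℕ) (u : ZSigma S) : FreeGroup (Fin r) →* FreePro S r :=
  FreeGroup.lift fun i => spow (gen i) u

theorem SigmaLimit.hom_eq (L : SigmaLimit S H) {r : ℕ} {θ η : FreePro S r →* H} (hθ : L.Cont θ)
    (hη : L.Cont η) (h : ∀ i, θ (gen i) = η (gen i)) : θ = η := by
  have key : θ.comp toCompletion = η.comp toCompletion := FreeGroup.ext_hom _ _ h
  rw [L.ext_unique (θ.comp toCompletion) θ hθ fun _ => rfl,
    L.ext_unique (η.comp toCompletion) η hη fun _ => rfl, key]

theorem map_spow_completion {F' : Type*} [Group F'] {θ : proCompletion S F' →* proCompletion S F}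
    (hθ : (limitCompletion S F).Cont θ) (w : proCompletion S F') (u : ZSigma S) :
    θ (spow w u) = spow (θ w) u := by
  refine Subtype.ext (funext fun N => ?_)
  obtain ⟨e, he, h⟩ := hθ.map_spow w u N ⟨N.1.index, N.2.2⟩
  have h' : ((θ w).1 N ^ e)⁻¹ * (θ (spow w u)).1 N = 1 := h
  rw [spow_apply _ u N e he, inv_mul_eq_one.1 h']

/-- The continuous endomorphism of the free pro-`S` group with `γ_i ↦ γ_i ^ u`, as a function of
`u`. -/
noncomputable def powEnd (S : Set ℕ) (r : ℕ) : ZSigma S →* Monoid.End (FreePro S r) where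
  toFun u := (limitCompletion S (FreeGroup (Fin r))).ext (freePow r u)
  map_one' := by
    refine (limitCompletion S _).hom_eq ((limitCompletion S _).cont_ext _)
      (fun a => ⟨a, fun w hw => hw⟩) fun i => ?_
    refine (SigmaLimit.ext_toCompletion _ _ _).trans ?_
    rw [freePow, FreeGroup.lift_apply_of, spow_one]; rfl
  map_mul' u v := by
    refine (limitCompletion S _).hom_eq ((limitCompletion S _).cont_ext _)
      (((limitCompletion S _).cont_ext _).comp ((limitCompletion S _).cont_ext _)) fun i => ?_
    have h1 : ∀ z : ZSigma S,
        (limitCompletion S (FreeGroup (Fin r))).ext (freePow r z) (gen i) = spow (gen i) z := by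
      intro z
      rw [gen, SigmaLimit.ext_toCompletion]
      simp [freePow, gen]
    refine (h1 _).trans (Eq.symm ?_)
    refine (congrArg ((limitCompletion S (FreeGroup (Fin r))).ext (freePow r u)) (h1 v)).trans ?_
    rw [map_spow_completion ((limitCompletion S _).cont_ext _), h1,
      spow_mul]

theorem powEnd_gen {r : ℕ} (u : ZSigma S) (i : Fin r) :
    powEnd S r u (gen i) = spow (gen i) u := by
  change (limitCompletion S (FreeGroup (Fin r))).ext (freePow r u) (gen i) = _
  rw [gen, SigmaLimit.ext_toCompletion]
  simp [freePow, gen]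

theorem continuous_powEnd (r : ℕ) :
    Continuous fun p : ZSigma S × FreePro S r => powEnd S r p.1 p.2 := by
  refine Continuous.subtype_mk (continuous_pi fun N => ?_) _
  refine continuous_iff_continuousAt.2 fun ⟨u, w⟩ => ?_
  let L := limitCompletion S (FreeGroup (Fin r))
  let M := L.pull (freePow r u) N
  have c1 : Continuous fun p : ZSigma S × FreePro S r => p.1.1 ⟨N.1.index, N.2.2⟩ :=
    (continuous_apply _).comp (continuous_subtype_val.comp continuous_fst)
  have c2 : Continuous fun p : ZSigma S × FreePro S r => p.2.1 M :=
    (continuous_apply _).comp (continuous_subtype_val.comp continuous_snd)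
  have e1 : ∀ᶠ p in nhds (u, w), p.1.1 ⟨N.1.index, N.2.2⟩ = u.1 ⟨N.1.index, N.2.2⟩ :=
    c1.continuousAt.eventually ((isOpen_discrete {u.1 ⟨N.1.index, N.2.2⟩}).mem_nhds (Set.mem_singleton _))
  have e2 : ∀ᶠ p in nhds (u, w), p.2.1 M = w.1 M :=
    c2.continuousAt.eventually ((isOpen_discrete {w.1 M}).mem_nhds (Set.mem_singleton _))
  refine (continuousAt_const (y := (powEnd S r u w).1 N)).congr ?_
  filter_upwards [e1, e2] with p h1 h2
  have hf : ∀ y, (freePow r p.1 y).1 N = (freePow r u y).1 N := by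
    intro y
    have : ((Pi.evalMonoidHom _ N).comp (proCompletion S _).subtype).comp (freePow r p.1) =
        ((Pi.evalMonoidHom _ N).comp (proCompletion S _).subtype).comp (freePow r u) := by
      refine FreeGroup.ext_hom _ _ fun i => ?_
      simp only [freePow, MonoidHom.comp_apply, FreeGroup.lift_apply_of]
      change (gen i).1 N ^ (p.1.1 ⟨N.1.index, N.2.2⟩).val = (gen i).1 N ^ (u.1 _).val
      rw [h1]
    exact DFunLike.congr_fun this y
  have hM : L.pull (freePow r p.1) N = M := by
    refine Subtype.ext (Subgroup.ext fun y => ?_)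
    change (freePow r p.1 y).1 N = 1 ↔ (freePow r u y).1 N = 1
    rw [hf]
  obtain ⟨y, hy⟩ := FinQuot.mk_surjective M (w.1 M)
  have k1 : ((freePow r u y).1 N)⁻¹ * (powEnd S r u w).1 N = 1 :=
    L.ext_spec (freePow r u) w N y hy.symm
  have k2 : ((freePow r p.1 y).1 N)⁻¹ * (powEnd S r p.1 p.2).1 N = 1 :=
    L.ext_spec (freePow r p.1) p.2 N y (by rw [hM, h2, hy])
  exact (inv_mul_eq_one.1 k1).symm.trans ((hf y).symm.trans (inv_mul_eq_one.1 k2))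

/-- The `i`-th coordinate of the map from the free pro-`S` group to `(ℤ^S)^r` determined by the
basis: the continuous homomorphism with `γ_i ↦ 1` and `γ_k ↦ 0` for `k ≠ i`. -/
noncomputable def coord {r : ℕ} (i : Fin r) : FreePro S r →* Multiplicative (ZSigma S) :=
  (limitZSigma S).ext
    (FreeGroup.lift fun k => Multiplicative.ofAdd (if k = i then (1 : ZSigma S) else 0))

theorem continuous_coord {r : ℕ} (i : Fin r) :
    Continuous fun w : FreePro S r => (coord i w).toAdd := by
  refine continuous_induced_rng.2 (continuous_pi fun m => ?_)
  refine continuous_iff_continuousAt.2 fun w => ?_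
  refine (continuousAt_const (y := ((coord i w).toAdd).1 m)).congr ?_
  filter_upwards [(limitZSigma S).isOpen_ext _ w m] with v hv
  have hv' : -((coord i w).toAdd).1 m + ((coord i v).toAdd).1 m = 0 := hv
  exact neg_add_eq_zero.1 hv'

theorem coord_powEnd {r : ℕ} (i : Fin r) (u : ZSigma S) (w : FreePro S r) :
    (coord i (powEnd S r u w)).toAdd = u * (coord i w).toAdd := by
  have hc : (limitZSigma S).Cont (coord (S := S) i) := (limitZSigma S).cont_ext _
  let η : FreePro S r →* Multiplicative (ZSigma S) :=
    (AddMonoidHom.toMultiplicative (AddMonoidHom.mulLeft u)).comp (coord i)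
  have hη : (limitZSigma S).Cont η := fun m => by
    obtain ⟨N, hN⟩ := hc m
    refine ⟨N, fun w hw => ?_⟩
    have h : ((coord i w).toAdd).1 m = 0 := hN w hw
    change u.1 m * ((coord i w).toAdd).1 m = 0
    rw [h, mul_zero]
  have key : (coord i).comp (powEnd S r u) = η := by
    refine (limitZSigma S).hom_eq (hc.comp ((limitCompletion S _).cont_ext _)) hη fun k => ?_
    refine (congrArg (coord i) (powEnd_gen u k)).trans ?_
    refine Multiplicative.toAdd.injective (Subtype.ext (funext fun m => ?_))
    obtain ⟨e, he, h⟩ := hc.map_spow (gen k) u m m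
    have h' : -(e • ((coord i (gen k)).toAdd).1 m) + ((coord i (spow (gen k) u)).toAdd).1 m = 0 :=
      h
    rw [← neg_add_eq_zero.1 h', nsmul_eq_mul, he]; rfl
  exact congrArg Multiplicative.toAdd (DFunLike.congr_fun key w)

end Completion

/-! ### Unipotent matrices -/

section Unipotent

variable {R : Type*} [CommRing R] {n : ℕ}

/-- `X_{ij} = 0` for `j < i + k`. -/
def StrictUpper (k : ℕ) (X : Matrix (Fin (n + 1)) (Fin (n + 1)) R) : Prop :=
  ∀ i j : Fin (n + 1), (j : ℕ) < i + k → X i j = 0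

theorem StrictUpper.mul {k l : ℕ} {X Y : Matrix (Fin (n + 1)) (Fin (n + 1)) R}
    (hX : StrictUpper k X) (hY : StrictUpper l Y) : StrictUpper (k + l) (X * Y) := by
  intro i j hij
  rw [Matrix.mul_apply]
  refine Finset.sum_eq_zero fun p _ => ?_
  by_cases hp : (p : ℕ) < i + k
  · rw [hX i p hp, zero_mul]
  · rw [hY p j (by omega), mul_zero]

theorem StrictUpper.mono {k l : ℕ} (h : l ≤ k) {X : Matrix (Fin (n + 1)) (Fin (n + 1)) R}
    (hX : StrictUpper k X) : StrictUpper l X := fun i j hij => hX i j (by omega)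

theorem StrictUpper.add {k : ℕ} {X Y : Matrix (Fin (n + 1)) (Fin (n + 1)) R}
    (hX : StrictUpper k X) (hY : StrictUpper k Y) : StrictUpper k (X + Y) := fun i j hij => by
  rw [Matrix.add_apply, hX i j hij, hY i j hij, add_zero]

theorem StrictUpper.neg {k : ℕ} {X : Matrix (Fin (n + 1)) (Fin (n + 1)) R}
    (hX : StrictUpper k X) : StrictUpper k (-X) := fun i j hij => by
  rw [Matrix.neg_apply, hX i j hij, neg_zero]

theorem StrictUpper.sub {k : ℕ} {X Y : Matrix (Fin (n + 1)) (Fin (n + 1)) R}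
    (hX : StrictUpper k X) (hY : StrictUpper k Y) : StrictUpper k (X - Y) := by
  rw [sub_eq_add_neg]; exact hX.add hY.neg

theorem strictUpper_one : StrictUpper 0 (1 : Matrix (Fin (n + 1)) (Fin (n + 1)) R) :=
  fun i j hij => Matrix.one_apply_ne fun h => by subst h; omega

theorem StrictUpper.inv {A : (Matrix (Fin (n + 1)) (Fin (n + 1)) R)ˣ}
    (h : StrictUpper 0 A.1) : StrictUpper 0 (A⁻¹).1 := by
  have : Invertible A.1 := A.invertible
  have h' : Matrix.BlockTriangular A.1 id := fun i j hij => h i j (by simpa using hij)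
  have := Matrix.blockTriangular_inv_of_blockTriangular h'
  intro i j hij
  rw [Matrix.coe_units_inv]
  exact this (by simpa using hij)

theorem StrictUpper.inv_sub_one {k : ℕ} {A : (Matrix (Fin (n + 1)) (Fin (n + 1)) R)ˣ}
    (h0 : StrictUpper 0 A.1) (h : StrictUpper k (A.1 - 1)) : StrictUpper k ((A⁻¹).1 - 1) := by
  have : (A⁻¹).1 - 1 = -((A⁻¹).1 * (A.1 - 1)) := by
    rw [mul_sub, Units.inv_mul, mul_one, neg_sub]
  rw [this]
  simpa using (h0.inv.mul h).neg

theorem StrictUpper.mul_sub_one {k : ℕ} {A B : Matrix (Fin (n + 1)) (Fin (n + 1)) R}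
    (h0 : StrictUpper 0 B) (hA : StrictUpper k (A - 1)) (hB : StrictUpper k (B - 1)) :
    StrictUpper k (A * B - 1) := by
  have : A * B - 1 = (A - 1) * B + (B - 1) := by rw [sub_mul, one_mul]; abel
  rw [this]
  exact StrictUpper.add (by simpa using hA.mul h0) hB

theorem strictUpper_sub_one_iff {A : Matrix (Fin (n + 1)) (Fin (n + 1)) R} :
    StrictUpper 1 (A - 1) ↔
      ∀ i j : Fin (n + 1), j ≤ i → A i j = (1 : Matrix (Fin (n + 1)) (Fin (n + 1)) R) i j := by
  constructor
  · intro h i j hij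
    exact sub_eq_zero.1 (h i j (Nat.lt_succ_of_le hij))
  · intro h i j hij
    rw [Matrix.sub_apply, h i j (Nat.le_of_lt_succ hij), sub_self]

theorem StrictUpper.zero_of_one {A : Matrix (Fin (n + 1)) (Fin (n + 1)) R}
    (h : StrictUpper 1 (A - 1)) : StrictUpper 0 A := by
  simpa using (h.mono zero_le_one).add strictUpper_one

variable (R n) in
/-- The group `U_{n+1}` of upper triangular `(n+1) × (n+1)` matrices with all diagonal entries
equal to `1`. -/
def Unip : Subgroup (Matrix (Fin (n + 1)) (Fin (n + 1)) R)ˣ where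
  carrier := {A | ∀ i j : Fin (n + 1), j ≤ i →
    A.1 i j = (1 : Matrix (Fin (n + 1)) (Fin (n + 1)) R) i j}
  one_mem' _ _ _ := rfl
  mul_mem' {A B} hA hB := by
    have hA := strictUpper_sub_one_iff.2 hA
    have hB := strictUpper_sub_one_iff.2 hB
    exact strictUpper_sub_one_iff.1 (StrictUpper.mul_sub_one hB.zero_of_one hA hB)
  inv_mem' {A} hA := by
    have hA := strictUpper_sub_one_iff.2 hA
    exact strictUpper_sub_one_iff.1 (StrictUpper.inv_sub_one hA.zero_of_one hA)

/-- The matrix entry `a_{ij}`, with rows and columns numbered from `0` to `n`. -/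
def Unip.entry (i j : Fin (n + 1)) (A : Unip R n) : R := A.1.1 i j

theorem Unip.strictUpper (A : Unip R n) : StrictUpper 1 (A.1.1 - 1) :=
  strictUpper_sub_one_iff.2 A.2

theorem Unip.ext_entry {A B : Unip R n} (h : ∀ i j, Unip.entry i j A = Unip.entry i j B) :
    A = B :=
  Subtype.ext (Units.ext (Matrix.ext h))

/-- A unipotent upper triangular matrix as an element of `U_{n+1}`. -/
noncomputable def Unip.ofMatrix (A : Matrix (Fin (n + 1)) (Fin (n + 1)) R)
    (h : ∀ i j : Fin (n + 1), j ≤ i →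
      A i j = (1 : Matrix (Fin (n + 1)) (Fin (n + 1)) R) i j) : Unip R n :=
  ⟨A.nonsingInvUnit (by
    have hA : A.IsUpperTriangular := fun i j hij => by
      exact (h i j (le_of_lt hij)).trans (Matrix.one_apply_ne (ne_of_gt hij : i ≠ j))
    have : A.det = 1 := by
      rw [Matrix.det_of_isUpperTriangular hA]
      exact Finset.prod_eq_one fun i _ => by rw [h i i le_rfl, Matrix.one_apply_eq]
    rw [this]; exact isUnit_one), h⟩

/-- The subgroup of matrices in `U_{n+1}` with `a_{ij} = 0` for `0 < j - i < k`. -/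
def Unip.filt (k : ℕ) : Subgroup (Unip R n) where
  carrier := {A | StrictUpper k (A.1.1 - 1)}
  one_mem' i j _ := by simp
  mul_mem' {A B} hA hB := StrictUpper.mul_sub_one (Unip.strictUpper B).zero_of_one hA hB
  inv_mem' {A} hA := StrictUpper.inv_sub_one (Unip.strictUpper A).zero_of_one hA

theorem Unip.filt_zero : Unip.filt (R := R) (n := n) 0 = ⊤ :=
  top_unique fun A _ => (Unip.strictUpper A).mono zero_le_one

theorem Unip.filt_one : Unip.filt (R := R) (n := n) 1 = ⊤ :=
  top_unique fun A _ => (Unip.strictUpper A)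

theorem Unip.commutator_filt_le (k : ℕ) :
    ⁅(⊤ : Subgroup (Unip R n)), Unip.filt (R := R) (n := n) k⁆ ≤ Unip.filt (k + 1) := by
  rw [Subgroup.commutator_le]
  intro A _ B hB
  have hB : StrictUpper k (B.1.1 - 1) := hB
  have hA := (Unip.strictUpper A)
  have e : (A.1 * B.1 * A.1⁻¹ * B.1⁻¹).1 - 1 =
      ((A.1.1 - 1) * (B.1.1 - 1) - (B.1.1 - 1) * (A.1.1 - 1)) * ((A⁻¹).1.1 * (B⁻¹).1.1) := by
    have h1 : (A.1.1 - 1) * (B.1.1 - 1) - (B.1.1 - 1) * (A.1.1 - 1) =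
        A.1.1 * B.1.1 - B.1.1 * A.1.1 := by noncomm_ring
    have h2 : B.1.1 * A.1.1 * ((A⁻¹).1.1 * (B⁻¹).1.1) = 1 := by
      change (B.1 * A.1 * (A.1⁻¹ * B.1⁻¹)).1 = 1
      rw [mul_assoc, mul_inv_cancel_left, mul_inv_cancel, Units.val_one]
    rw [h1, sub_mul, h2]
    simp [mul_assoc]
  change StrictUpper (k + 1) ((A.1 * B.1 * A.1⁻¹ * B.1⁻¹).1 - 1)
  rw [e]
  have h3 : StrictUpper (k + 1) ((A.1.1 - 1) * (B.1.1 - 1) - (B.1.1 - 1) * (A.1.1 - 1)) :=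
    StrictUpper.sub (by simpa [add_comm] using hA.mul hB) (hB.mul hA)
  have h4 : StrictUpper 0 ((A⁻¹).1.1 * (B⁻¹).1.1) :=
    (Unip.strictUpper A⁻¹).zero_of_one.mul (Unip.strictUpper B⁻¹).zero_of_one
  exact h3.mul h4

theorem Unip.mem_filt_iff (A : Unip R n) :
    A ∈ Unip.filt (R := R) (n := n) n ↔
      ∀ i j : Fin (n + 1), i < j → (i, j) ≠ (0, Fin.last n) → Unip.entry i j A = 0 := by
  constructor
  · intro h i j hij hne
    have h1 : (j : ℕ) < i + n := by
      by_contra hc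
      apply hne
      have := j.2
      refine Prod.ext (Fin.ext ?_) (Fin.ext ?_) <;> simp only [Fin.val_zero, Fin.val_last] <;> omega
    have := h i j h1
    rwa [Matrix.sub_apply, Matrix.one_apply_ne (ne_of_lt hij), sub_zero] at this
  · intro h i j hij
    rcases lt_or_ge i j with h1 | h1
    · rw [Matrix.sub_apply, Matrix.one_apply_ne (ne_of_lt h1), sub_zero]
      refine h i j h1 fun hc => ?_
      rw [Prod.mk.injEq] at hc
      rw [hc.1, hc.2] at hij
      simp at hij
    · exact (Unip.strictUpper A) i j (Nat.lt_succ_of_le h1)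

variable (R n) in
/-- The image of the additive group of `R` in `U_{n+1}`: the matrices whose only non-zero entry
off the diagonal is `a_{1,n+1}` (that is, the entry `(0, n)` when counted from `0`). -/
def Unip.corner : Subgroup (Unip R n) :=
  (Unip.filt (R := R) (n := n) n).copy
    {A | ∀ i j : Fin (n + 1), i < j → (i, j) ≠ (0, Fin.last n) → Unip.entry i j A = 0}
    (Set.ext fun A => (Unip.mem_filt_iff A).symm)

theorem Unip.corner_eq : Unip.corner R n = Unip.filt n := Subgroup.copy_eq _ _ _

instance Unip.filt_normal (k : ℕ) : (Unip.filt (R := R) (n := n) k).Normal :=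
  ⟨fun B hB A => by
    have h := Unip.commutator_filt_le k (Subgroup.commutator_mem_commutator
      (Subgroup.mem_top A) hB)
    have h' : A * B * A⁻¹ * B⁻¹ ∈ Unip.filt (R := R) (n := n) k :=
      StrictUpper.mono (Nat.le_succ k) h
    simpa using mul_mem h' hB⟩

instance : (Unip.corner R n).Normal := by rw [Unip.corner_eq]; infer_instance

variable (R n) in
/-- The quotient `Ū_{n+1}` of `U_{n+1}` by the corner subgroup. -/
abbrev UnipBar : Type _ := Unip R n ⧸ Unip.corner R n

theorem Unip.entry_mul (i j : Fin (n + 1)) (A B : Unip R n) :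
    Unip.entry i j (A * B) = ∑ p, Unip.entry i p A * Unip.entry p j B := Matrix.mul_apply

open Classical in
/-- The matrix entry `a_{ij}` on `Ū_{n+1}`, for `(i,j) ≠ (1,n+1)`. The corner entry does not make
sense on `Ū_{n+1}`; it is given the value `0` and never used. -/
noncomputable def UnipBar.entry (i j : Fin (n + 1)) (A : UnipBar R n) : R :=
  if h : (i, j) = (0, Fin.last n) then 0 else
    Quotient.liftOn' A (Unip.entry i j) (fun A B hAB => by
      rw [QuotientGroup.leftRel_apply] at hAB
      have e : B = A * (A⁻¹ * B) := by group
      rw [e, Unip.entry_mul, Finset.sum_eq_single j]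
      · rw [show Unip.entry j j (A⁻¹ * B) = 1 from
          ((A⁻¹ * B).2 j j le_rfl).trans (Matrix.one_apply_eq _), mul_one]
      · intro p _ hp
        rcases lt_or_gt_of_ne hp with h1 | h1
        · by_cases h2 : (p, j) = (0, Fin.last n)
          · rw [Prod.mk.injEq] at h2
            have hi : p < i := by
              rw [h2.1]
              refine Fin.pos_of_ne_zero fun h3 => h ?_
              rw [h3, h2.2]
            rw [show Unip.entry i p A = 0 from
              (A.2 i p hi.le).trans (Matrix.one_apply_ne hi.ne'), zero_mul]
          · rw [hAB p j h1 h2, mul_zero]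
        · rw [show Unip.entry p j (A⁻¹ * B) = 0 from
            ((A⁻¹ * B).2 p j h1.le).trans (Matrix.one_apply_ne h1.ne'), mul_zero]
      · simp)

theorem UnipBar.entry_mk {i j : Fin (n + 1)} (h : (i, j) ≠ (0, Fin.last n)) (A : Unip R n) :
    UnipBar.entry i j (A : UnipBar R n) = Unip.entry i j A := dif_neg h

/-- The homomorphism of unipotent groups induced by a ring homomorphism. -/
def Unip.map {R' : Type*} [CommRing R'] (f : R →+* R') : Unip R n →* Unip R' n :=
  ((Units.map (f.mapMatrix : _ →+* Matrix (Fin (n + 1)) (Fin (n + 1)) R').toMonoidHom).comp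
    (Unip R n).subtype).codRestrict (Unip R' n) (fun A i j hij => by
      change f (A.1.1 i j) = _
      rw [A.2 i j hij, Matrix.one_apply, Matrix.one_apply]
      split_ifs
      · exact map_one f
      · exact map_zero f)

theorem Unip.entry_map {R' : Type*} [CommRing R'] (f : R →+* R') (i j : Fin (n + 1))
    (A : Unip R n) : Unip.entry i j (Unip.map f A) = f (Unip.entry i j A) := rfl

theorem StrictUpper.pow {X : Matrix (Fin (n + 1)) (Fin (n + 1)) R} (hX : StrictUpper 1 X)
    (k : ℕ) : StrictUpper k (X ^ k) := by
  induction k with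
  | zero => rw [pow_zero]; exact strictUpper_one
  | succ k ih => rw [pow_succ]; exact ih.mul hX

theorem StrictUpper.isNilpotent {X : Matrix (Fin (n + 1)) (Fin (n + 1)) R}
    (hX : StrictUpper 1 X) : IsNilpotent X :=
  ⟨n + 1, Matrix.ext fun i j => hX.pow (n + 1) i j (by have := j.2; omega)⟩

theorem Unip.eq_one_of_pow {p : ℕ} (hp : IsUnit (p : R)) (A : Unip R n) (h : A ^ p = 1) :
    A = 1 := by
  have hA : A.1.1 ^ p = 1 := congrArg (fun B : Unip R n => B.1.1) h
  have h1 : (A.1.1 - 1) * ∑ i ∈ Finset.range p, A.1.1 ^ i = 0 := by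
    rw [mul_geom_sum, hA, sub_self]
  have hcomm : ∀ i, A.1.1 ^ i - 1 = (A.1.1 - 1) * ∑ k ∈ Finset.range i, A.1.1 ^ k := fun i =>
    (mul_geom_sum _ _).symm
  have h2 : ∑ i ∈ Finset.range p, A.1.1 ^ i =
      (p : Matrix (Fin (n + 1)) (Fin (n + 1)) R) +
        (A.1.1 - 1) * ∑ i ∈ Finset.range p, ∑ k ∈ Finset.range i, A.1.1 ^ k := by
    rw [Finset.mul_sum, ← Finset.sum_congr rfl fun i _ => hcomm i]
    simp
  have hn : IsNilpotent ((A.1.1 - 1) *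
      ∑ i ∈ Finset.range p, ∑ k ∈ Finset.range i, A.1.1 ^ k) := by
    refine Commute.isNilpotent_mul_right ?_ (Unip.strictUpper A).isNilpotent
    refine Commute.sum_right _ _ _ fun i _ => Commute.sum_right _ _ _ fun k _ => ?_
    exact ((Commute.refl _).pow_right k).sub_left (Commute.one_left _)
  have hu : IsUnit (p : Matrix (Fin (n + 1)) (Fin (n + 1)) R) := by
    simpa using hp.map (algebraMap R (Matrix (Fin (n + 1)) (Fin (n + 1)) R))
  have h3 : IsUnit (∑ i ∈ Finset.range p, A.1.1 ^ i) := by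
    rw [h2]
    exact hn.isUnit_add_left_of_commute hu (Nat.cast_commute _ _).symm
  have h4 : A.1.1 - 1 = 0 := (h3.mul_left_eq_zero).1 h1
  exact Subtype.ext (Units.ext (sub_eq_zero.1 h4))

theorem isSigma_card_unip {S : Set ℕ} {m : ℕ} (hm : IsSigmaNumber S m) :
    IsSigmaNumber S (Nat.card (Unip (ZMod m) n)) := by
  have : NeZero m := ⟨hm.1⟩
  refine ⟨Nat.card_pos.ne', fun p hp hd => ?_⟩
  have : Fact p.Prime := ⟨hp⟩
  obtain ⟨A, hA⟩ := exists_prime_orderOf_dvd_card' p hd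
  refine hm.2 p hp ?_
  by_contra hc
  have hu : IsUnit (p : ZMod m) := (ZMod.isUnit_iff_coprime p m).2 ((hp.coprime_iff_not_dvd).2 hc)
  have h1 := Unip.eq_one_of_pow hu A (by rw [← hA]; exact pow_orderOf_eq_one A)
  rw [h1, orderOf_one] at hA
  exact hp.one_lt.ne hA

/-- The projection `ℤ^S → ℤ/m`. -/
def ZSigma.proj {S : Set ℕ} (m : {m : ℕ // IsSigmaNumber S m}) : ZSigma S →+* ZMod m.1 :=
  (Pi.evalRingHom _ m).comp (ZSigma S).subtype

/-- The group `U_{n+1}` over `ℤ^S`, presented by the kernels of the reductions modulo `m`. -/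
noncomputable def limitUnip (S : Set ℕ) (n : ℕ) : SigmaLimit S (Unip (ZSigma S) n) where
  ι := {m : ℕ // IsSigmaNumber S m}
  K m := (Unip.map (ZSigma.proj m)).ker
  normal _ := inferInstance
  isSigma m := by
    refine (isSigma_card_unip (n := n) m.2).of_dvd ?_
    rw [Subgroup.index_ker]
    exact Subgroup.card_subgroup_dvd_card _
  separated A hA := Unip.ext_entry fun i j => Subtype.ext (funext fun m => by
    have h := congrArg (Unip.entry i j) (hA m)
    rw [Unip.entry_map] at h
    refine h.trans ?_
    rw [← map_one (Unip.map (ZSigma.proj m)), Unip.entry_map]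
    rfl)
  complete h hh := by
    have key : ∀ (a : {m : ℕ // IsSigmaNumber S m}) (x y : Unip (ZSigma S) n),
        x⁻¹ * y ∈ (Unip.map (ZSigma.proj a)).ker ↔
          ∀ i j, (Unip.entry i j x).1 a = (Unip.entry i j y).1 a := by
      intro a x y
      rw [MonoidHom.mem_ker, map_mul, map_inv, inv_mul_eq_one]
      exact ⟨fun h i j => congrArg (Unip.entry i j) h, fun h => Unip.ext_entry h⟩
    simp only [key] at hh ⊢
    refine ⟨Unip.ofMatrix (fun i j => ⟨fun m => (Unip.entry i j (h m)).1 m, fun m m' hm => ?_⟩)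
      fun i j hij => Subtype.ext (funext fun m => ?_), fun _ _ _ => rfl⟩
    · obtain ⟨x, h1, h2⟩ := hh m m'
      exact (congrArg _ (h2 i j)).trans
        (((Unip.entry i j x).2 m m' hm).trans (h1 i j).symm)
    · have e : Unip.entry i j (h m) =
          (1 : Matrix (Fin (n + 1)) (Fin (n + 1)) (ZSigma S)) i j := (h m).2 i j hij
      have e' : (Unip.entry i j (h m)).1 m =
          ((1 : Matrix (Fin (n + 1)) (Fin (n + 1)) (ZSigma S)) i j).1 m :=
        congrArg (fun z : ZSigma S => z.1 m) e
      exact e'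

/-- The matrix with entries `1/(j-i)!` for `i < j` such that `J(v) = k` for all `i ≤ v < j`, with
ones on the diagonal and zeros elsewhere. (Here `Ring.inverse` is the inverse of a unit.) -/
noncomputable def expMatrix {r : ℕ} (J : Fin n → Fin r) (k : Fin r) : Unip R n :=
  open Classical in
  Unip.ofMatrix (fun i j =>
    if i < j ∧ ∀ v : Fin n, (i : ℕ) ≤ v → (v : ℕ) < j → J v = k then
      Ring.inverse ((Nat.factorial ((j : ℕ) - i) : ℕ) : R)
    else if i = j then 1 else 0) (fun i j hij => by
      rw [if_neg (fun h => absurd h.1 hij.not_gt), Matrix.one_apply])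

/-- The continuous homomorphism `φ_J` from the free pro-`S` group to `U_{n+1}` over `ℤ^S`. -/
noncomputable def phi {S : Set ℕ} {r : ℕ} (J : Fin n → Fin r) :
    FreePro S r →* Unip (ZSigma S) n :=
  (limitUnip S n).ext (FreeGroup.lift fun k => expMatrix J k)

theorem phi_gen {S : Set ℕ} {r : ℕ} (J : Fin n → Fin r) (k : Fin r) :
    phi J (gen k : FreePro S r) = expMatrix J k := by
  rw [phi, gen, SigmaLimit.ext_toCompletion, FreeGroup.lift_apply_of]

theorem continuous_entry_phi {S : Set ℕ} {r : ℕ} (J : Fin n → Fin r) (i j : Fin (n + 1)) :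
    Continuous fun w : FreePro S r => Unip.entry i j (phi J w) := by
  refine continuous_induced_rng.2 (continuous_pi fun m => ?_)
  refine continuous_iff_continuousAt.2 fun w => ?_
  refine (continuousAt_const (y := (Unip.entry i j (phi J w)).1 m)).congr ?_
  filter_upwards [(limitUnip S n).isOpen_ext _ w m] with v hv
  have hv' : (Unip.map (ZSigma.proj m) (phi J w))⁻¹ * Unip.map (ZSigma.proj m) (phi J v) = 1 := by
    rw [← map_inv, ← map_mul]; exact hv
  exact congrArg (Unip.entry i j) (inv_mul_eq_one.1 hv')

end Unipotent

/-! ### Lower central series of a topological group, continuous sections -/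

section Topological

variable {P : Type*} [Group P] [TopologicalSpace P] [IsTopologicalGroup P]

variable (P) in
/-- The lower central series `P = [P]_1 ⊇ [P]_2 ⊇ …`, where `[P]_{k+1}` is the closure of the
commutator subgroup `[P, [P]_k]`. (The index `0`, which is not part of the series, also gives
`P`.) -/
def lcs : ℕ → Subgroup P
  | 0 => ⊤
  | 1 => ⊤
  | (k + 2) => (⁅(⊤ : Subgroup P), lcs (k + 1)⁆).topologicalClosure

instance lcs_normal : ∀ k, (lcs P k).Normal
  | 0 => inferInstanceAs (⊤ : Subgroup P).Normal
  | 1 => inferInstanceAs (⊤ : Subgroup P).Normal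
  | (k + 2) => by
    have := lcs_normal (k + 1)
    exact Subgroup.is_normal_topologicalClosure _

theorem isClosed_lcs : ∀ k, IsClosed (lcs P k : Set P)
  | 0 => isClosed_univ
  | 1 => isClosed_univ
  | (_ + 2) => Subgroup.isClosed_topologicalClosure _

theorem commutator_lcs_le : ∀ k, ⁅(⊤ : Subgroup P), lcs P k⁆ ≤ lcs P (k + 1)
  | 0 => le_top
  | (_ + 1) => Subgroup.le_topologicalClosure _

theorem lcs_succ_le : ∀ k, lcs P (k + 1) ≤ lcs P k
  | 0 => le_top
  | (k + 1) => Subgroup.topologicalClosure_minimal _ (Subgroup.commutator_le_right _ _)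
      (isClosed_lcs (k + 1))

theorem lcs_antitone : Antitone (lcs P) := antitone_nat_of_succ_le lcs_succ_le

theorem lcs_le_of_closed (D : ℕ → Subgroup P) (hc : ∀ k, IsClosed (D k : Set P))
    (h0 : D 0 = ⊤) (h1 : D 1 = ⊤) (hD : ∀ k, ⁅(⊤ : Subgroup P), D k⁆ ≤ D (k + 1)) :
    ∀ k, lcs P k ≤ D k
  | 0 => h0.ge
  | 1 => h1.ge
  | (k + 2) => Subgroup.topologicalClosure_minimal _
      ((Subgroup.commutator_mono le_rfl (lcs_le_of_closed D hc h0 h1 hD (k + 1))).trans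
        (hD (k + 1))) (hc (k + 2))

theorem lcs_le_comap (f : P →* P) (hf : Continuous f) (k : ℕ) :
    lcs P k ≤ (lcs P k).comap f := by
  refine lcs_le_of_closed (fun k => (lcs P k).comap f) (fun k => (isClosed_lcs k).preimage hf)
    rfl rfl (fun k => ?_) k
  rw [← Subgroup.map_le_iff_le_comap, Subgroup.map_commutator]
  exact (Subgroup.commutator_mono le_top (Subgroup.map_comap_le _ _)).trans (commutator_lcs_le k)

/-- The quotient map of a profinite group by a closed subgroup has a continuous section. -/
theorem exists_continuous_section [CompactSpace P] [TotallyDisconnectedSpace P] (K : Subgroup P)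
    (hK : IsClosed (K : Set P)) :
    ∃ σ : P ⧸ K → P, Continuous σ ∧ ∀ q, (σ q : P ⧸ K) = q := by
  let C : Set (Set P) := {T | IsClosed T ∧ (∀ g, ∃ s ∈ T, g⁻¹ * s ∈ K) ∧
    ∃ L : Subgroup P, L ≤ K ∧ (∀ s ∈ T, ∀ l ∈ L, s * l ∈ T) ∧
      ∀ s ∈ T, ∀ t ∈ T, s⁻¹ * t ∈ K → s⁻¹ * t ∈ L}
  have hcoset : ∀ g : P, IsClosed {s : P | g⁻¹ * s ∈ K} := fun g =>
    hK.preimage (continuous_const.mul continuous_id)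
  have huniv : Set.univ ∈ C := ⟨isClosed_univ, fun g => ⟨g, trivial, by simp⟩, K, le_rfl,
    fun _ _ _ _ => trivial, fun _ _ _ _ h => h⟩
  obtain ⟨T, -, hmin⟩ := zorn_superset_nonempty C (by
    intro c hc hchain hne
    refine ⟨⋂₀ c, ⟨isClosed_sInter fun T hT => (hc hT).1, fun g => ?_, ?_⟩,
      fun T hT => Set.sInter_subset_of_mem hT⟩
    · have hn : (⋂₀ ((fun T => T ∩ {s | g⁻¹ * s ∈ K}) '' c)).Nonempty := by
        refine IsCompact.nonempty_sInter_of_directed_nonempty_isCompact_isClosed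
          (hS := (hne.image _).to_subtype) ?_ ?_ ?_ ?_
        · rintro _ ⟨T, hT, rfl⟩ _ ⟨T', hT', rfl⟩
          rcases hchain.total hT hT' with h | h
          · exact ⟨_, ⟨T, hT, rfl⟩, subset_rfl, Set.inter_subset_inter_left _ h⟩
          · exact ⟨_, ⟨T', hT', rfl⟩, Set.inter_subset_inter_left _ h, subset_rfl⟩
        · rintro _ ⟨T, hT, rfl⟩
          obtain ⟨s, hs, hs'⟩ := (hc hT).2.1 g
          exact ⟨s, hs, hs'⟩
        · rintro _ ⟨T, hT, rfl⟩
          exact ((hc hT).1.inter (hcoset g)).isCompact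
        · rintro _ ⟨T, hT, rfl⟩
          exact (hc hT).1.inter (hcoset g)
      obtain ⟨s, hs⟩ := hn
      obtain ⟨T₀, hT₀⟩ := hne
      exact ⟨s, fun T hT => (hs _ ⟨T, hT, rfl⟩).1, (hs _ ⟨T₀, hT₀, rfl⟩).2⟩
    · choose L hL using fun T : c => (hc T.2).2.2
      obtain ⟨T₀, hT₀⟩ := hne
      refine ⟨⨅ T : c, L T, (iInf_le _ ⟨T₀, hT₀⟩).trans (hL ⟨T₀, hT₀⟩).1, ?_, ?_⟩
      · intro s hs l hl T hT
        exact (hL ⟨T, hT⟩).2.1 s (hs T hT) l ((Subgroup.mem_iInf.1 hl) ⟨T, hT⟩)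
      · intro s hs t ht hst
        exact Subgroup.mem_iInf.2 fun T => (hL T).2.2 s (hs T T.2) t (ht T T.2) hst) Set.univ huniv
  obtain ⟨hTc, hTm, L, hLK, hTL, hLT⟩ := hmin.prop
  have hL1 : ∀ l ∈ L, l = 1 := by
    intro l hl
    by_contra hne
    obtain ⟨U, hU⟩ := ProfiniteGrp.exist_openNormalSubgroup_sub_open_nhds_of_one
      (isOpen_compl_singleton (x := l)) (fun h => hne h.symm)
    have hlU : l ∉ (U : Set P) := fun h => hU h rfl
    let V : Subgroup P := U.toSubgroup ⊔ L
    have hV : IsOpen (V : Set P) := Subgroup.isOpen_mono le_sup_left U.isOpen'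
    have hdisc : DiscreteTopology (P ⧸ V) := QuotientGroup.discreteTopology hV
    let T' : Set P := T ∩ {z | (Quotient.out (z : P ⧸ V))⁻¹ * z ∈ (U : Set P)}
    have hT' : T' ∈ C := by
      refine ⟨hTc.inter ?_, ?_, L ⊓ U.toSubgroup, inf_le_left.trans hLK, ?_, ?_⟩
      · refine (U.toOpenSubgroup.isClosed).preimage (Continuous.mul ?_ continuous_id)
        exact ((continuous_of_discreteTopology (f := fun q : P ⧸ V => (Quotient.out q)⁻¹)).comp
          continuous_quotient_mk')
      · intro g
        obtain ⟨s, hs, hgs⟩ := hTm g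
        have h1 : (Quotient.out (s : P ⧸ V))⁻¹ * s ∈ V :=
          QuotientGroup.eq.1 (Quotient.out_eq' (s : P ⧸ V))
        obtain ⟨u, hu, l', hl', h2⟩ := Subgroup.mem_sup_of_normal_left.1 h1
        have h3 : ((s * l'⁻¹ : P) : P ⧸ V) = s := by
          rw [eq_comm, QuotientGroup.eq]
          simpa using V.inv_mem (le_sup_right (a := U.toSubgroup) hl')
        refine ⟨s * l'⁻¹, ⟨hTL s hs _ (L.inv_mem hl'), ?_⟩, ?_⟩
        · change (Quotient.out ((s * l'⁻¹ : P) : P ⧸ V))⁻¹ * (s * l'⁻¹) ∈ (U : Set P)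
          rw [h3, ← mul_assoc, ← h2, mul_inv_cancel_right]
          exact hu
        · rw [← mul_assoc]
          exact K.mul_mem hgs (K.inv_mem (hLK hl'))
      · rintro s ⟨hs, hs'⟩ l' ⟨hl', hl''⟩
        refine ⟨hTL s hs l' hl', ?_⟩
        have h3 : ((s * l' : P) : P ⧸ V) = s := by
          rw [eq_comm, QuotientGroup.eq]
          simpa using le_sup_right (a := U.toSubgroup) hl'
        change (Quotient.out ((s * l' : P) : P ⧸ V))⁻¹ * (s * l') ∈ U.toSubgroup
        rw [h3, ← mul_assoc]
        exact U.toSubgroup.mul_mem hs' hl''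
      · rintro s ⟨hs, hs'⟩ t ⟨ht, ht'⟩ hst
        have h1 := hLT s hs t ht hst
        refine ⟨h1, ?_⟩
        have h3 : (s : P ⧸ V) = t :=
          QuotientGroup.eq.2 (le_sup_right (a := U.toSubgroup) h1)
        have hs'' : (Quotient.out (t : P ⧸ V))⁻¹ * s ∈ U.toSubgroup := by
          rw [← h3]; exact hs'
        have := U.toSubgroup.mul_mem (U.toSubgroup.inv_mem hs'') ht'
        simpa [mul_assoc] using this
    have hTT' : T ⊆ T' := hmin.le_of_le hT' Set.inter_subset_left
    obtain ⟨s, hs, -⟩ := hTm 1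
    have h1 := hTT' (hTL s hs l hl)
    have h2 := hTT' hs
    have h3 : ((s * l : P) : P ⧸ V) = s := by
      rw [eq_comm, QuotientGroup.eq]
      simpa using le_sup_right (a := U.toSubgroup) hl
    have h4 : (Quotient.out ((s * l : P) : P ⧸ V))⁻¹ * (s * l) ∈ U.toSubgroup := h1.2
    rw [h3] at h4
    have := U.toSubgroup.mul_mem (U.toSubgroup.inv_mem h2.2) h4
    have h5 : l ∈ U.toSubgroup := by simpa [mul_assoc] using this
    exact hlU h5
  have hT2 : T2Space (P ⧸ K) := by
    have : IsClosed (K : Set P) := hK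
    infer_instance
  have hcs : CompactSpace T := isCompact_iff_compactSpace.1 hTc.isCompact
  let e : T → P ⧸ K := fun s => (s.1 : P ⧸ K)
  have he : Continuous e := continuous_quotient_mk'.comp continuous_subtype_val
  have hbij : Function.Bijective e := by
    constructor
    · intro s t hst
      have h := hL1 _ (hLT s.1 s.2 t.1 t.2 (QuotientGroup.eq.1 hst))
      exact Subtype.ext (inv_mul_eq_one.1 h)
    · intro q
      obtain ⟨g, rfl⟩ := QuotientGroup.mk_surjective q
      obtain ⟨s, hs, hgs⟩ := hTm g
      exact ⟨⟨s, hs⟩, (QuotientGroup.eq.2 hgs).symm⟩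
  let h : T ≃ₜ P ⧸ K := he.homeoOfEquivCompactToT2 (f := Equiv.ofBijective e hbij)
  exact ⟨fun q => (h.symm q).1, continuous_subtype_val.comp h.symm.continuous,
    fun q => h.apply_symm_apply q⟩

end Topological

/-! ### Continuous cohomology through inhomogeneous cochains -/

section Cohomology

variable {G : Type*} [Group G] [TopologicalSpace G]

/-- The continuous cocycles (twisted homomorphisms) of `G` with values in a possibly non-abelian
group `Q` on which `G` acts through `ρ`. -/
def Cocycle {Q : Type*} [Group Q] [TopologicalSpace Q] (ρ : G →* Monoid.End Q) : Type _ :=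
  {s : C(G, Q) // ∀ g h, s (g * h) = s g * ρ g (s h)}

/-- Cohomologous cocycles: `t(g) = q⁻¹ s(g) g(q)`. -/
def Cocycle.setoid {Q : Type*} [Group Q] [TopologicalSpace Q] (ρ : G →* Monoid.End Q) :
    Setoid (Cocycle ρ) where
  r s t := ∃ q : Q, ∀ g, t.1 g = q⁻¹ * s.1 g * ρ g q
  iseqv :=
    { refl := fun s => ⟨1, fun g => by simp⟩
      symm := by
        rintro s t ⟨q, hq⟩
        exact ⟨q⁻¹, fun g => by rw [hq g, map_inv]; group⟩
      trans := by
        rintro s t u ⟨q, hq⟩ ⟨q', hq'⟩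
        exact ⟨q * q', fun g => by rw [hq' g, hq g, map_mul]; group⟩ }

/-- The pointed set `H^1(G, Q)` for a possibly non-abelian `Q`. -/
def NonabH1 {Q : Type*} [Group Q] [TopologicalSpace Q] (ρ : G →* Monoid.End Q) : Type _ :=
  Quotient (Cocycle.setoid ρ)

/-- The class `[s]` of a cocycle `s`. -/
def NonabH1.mk {Q : Type*} [Group Q] [TopologicalSpace Q] {ρ : G →* Monoid.End Q}
    (s : Cocycle ρ) : NonabH1 ρ := Quotient.mk (Cocycle.setoid ρ) s

variable {A : Type*} [AddCommGroup A] [TopologicalSpace A] [IsTopologicalAddGroup A]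
  (ρ : G →* AddMonoid.End A)

/-- The coboundary `D` from `1`-cochains to `2`-cochains. -/
def dOne (b : G → A) : G × G → A := fun p => ρ p.1 (b p.2) - b (p.1 * p.2) + b p.1

/-- The coboundary `D` from `2`-cochains to `3`-cochains. -/
def dTwo (c : G × G → A) : G × G × G → A := fun p =>
  ρ p.1 (c (p.2.1, p.2.2)) - c (p.1 * p.2.1, p.2.2) + c (p.1, p.2.1 * p.2.2) - c (p.1, p.2.1)

/-- The continuous `1`-cocycles. -/
def Z1 : AddSubgroup C(G, A) where
  carrier := {b | dOne ρ b = 0}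
  zero_mem' := funext fun p => by simp [dOne]
  add_mem' {b c} hb hc := funext fun p => by
    have h1 := congrFun hb p
    have h2 := congrFun hc p
    simp only [dOne, Pi.zero_apply, ContinuousMap.add_apply, map_add] at h1 h2 ⊢
    rw [← add_zero (0 : A)]
    nth_rewrite 1 [← h1]
    rw [← h2]
    abel
  neg_mem' {b} hb := funext fun p => by
    have h1 := congrFun hb p
    simp only [dOne, Pi.zero_apply, ContinuousMap.neg_apply, map_neg] at h1 ⊢
    rw [← neg_zero, ← h1]
    abel

/-- The `1`-coboundaries. -/
def B1 : AddSubgroup C(G, A) where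
  carrier := {b | ∃ a : A, ∀ g, b g = ρ g a - a}
  zero_mem' := ⟨0, fun g => by simp⟩
  add_mem' := by
    rintro b c ⟨a, ha⟩ ⟨a', ha'⟩
    exact ⟨a + a', fun g => by rw [ContinuousMap.add_apply, ha, ha', map_add]; abel⟩
  neg_mem' := by
    rintro b ⟨a, ha⟩
    exact ⟨-a, fun g => by rw [ContinuousMap.neg_apply, ha, map_neg]; abel⟩

/-- The cohomology group `H^1(G, A)`. -/
def H1 : Type _ := Z1 ρ ⧸ (B1 ρ).addSubgroupOf (Z1 ρ)

instance : AddCommGroup (H1 ρ) :=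
  inferInstanceAs (AddCommGroup (Z1 ρ ⧸ (B1 ρ).addSubgroupOf (Z1 ρ)))

variable {ρ} in
/-- The class of a `1`-cocycle. -/
def H1.mk : Z1 ρ →+ H1 ρ := QuotientAddGroup.mk' ((B1 ρ).addSubgroupOf (Z1 ρ))

/-- The continuous `2`-cocycles. -/
def Z2 : AddSubgroup C(G × G, A) where
  carrier := {c | dTwo ρ c = 0}
  zero_mem' := funext fun p => by simp [dTwo]
  add_mem' {b c} hb hc := funext fun p => by
    have h1 := congrFun hb p
    have h2 := congrFun hc p
    simp only [dTwo, Pi.zero_apply, ContinuousMap.add_apply, map_add] at h1 h2 ⊢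
    rw [← add_zero (0 : A)]
    nth_rewrite 1 [← h1]
    rw [← h2]
    abel
  neg_mem' {b} hb := funext fun p => by
    have h1 := congrFun hb p
    simp only [dTwo, Pi.zero_apply, ContinuousMap.neg_apply, map_neg] at h1 ⊢
    rw [← neg_zero, ← h1]
    abel

/-- The `2`-coboundaries: coboundaries of continuous `1`-cochains. -/
def B2 : AddSubgroup C(G × G, A) where
  carrier := {c | ∃ b : C(G, A), (c : G × G → A) = dOne ρ b}
  zero_mem' := ⟨0, funext fun p => by simp [dOne]⟩
  add_mem' := by
    rintro b c ⟨a, ha⟩ ⟨a', ha'⟩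
    refine ⟨a + a', funext fun p => ?_⟩
    rw [ContinuousMap.add_apply, ha, ha']
    simp only [dOne, ContinuousMap.add_apply, map_add]
    abel
  neg_mem' := by
    rintro b ⟨a, ha⟩
    refine ⟨-a, funext fun p => ?_⟩
    rw [ContinuousMap.neg_apply, ha]
    simp only [dOne, ContinuousMap.neg_apply, map_neg]
    abel

/-- The cohomology group `H^2(G, A)`. -/
def H2 : Type _ := Z2 ρ ⧸ (B2 ρ).addSubgroupOf (Z2 ρ)

instance : AddCommGroup (H2 ρ) :=
  inferInstanceAs (AddCommGroup (Z2 ρ ⧸ (B2 ρ).addSubgroupOf (Z2 ρ)))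

variable {ρ} in
/-- The class of a `2`-cocycle. -/
def H2.mk : Z2 ρ →+ H2 ρ := QuotientAddGroup.mk' ((B2 ρ).addSubgroupOf (Z2 ρ))

end Cohomology

/-! ### Massey products -/

section Massey

variable {G : Type*} [Group G] [TopologicalSpace G]
variable {R : Type*} [CommRing R] [TopologicalSpace R]

/-- The `G`-module `R(χ^k)`: the element `g` acts on `R` as multiplication by `χ(g)^k`. -/
def twist (χ : G →ₜ* Rˣ) (k : ℕ) : G →* AddMonoid.End R :=
  (DistribMulAction.toAddMonoidEnd R R).comp
    ((powMonoidHom k).comp ((Units.coeHom R).comp χ.toMonoidHom))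

theorem twist_apply (χ : G →ₜ* Rˣ) (k : ℕ) (g : G) (a : R) :
    twist χ k g a = (χ g : R) ^ k * a := rfl

/-- The cup product of the `1`-cochain `c` with the `1`-cochain `d` valued in `R(χ^k)`. -/
def cup (χ : G →ₜ* Rˣ) (k : ℕ) (c d : G → R) : G × G → R :=
  fun p => c p.1 * twist χ k p.1 (d p.2)

variable [IsTopologicalRing R] {n : ℕ}

/-- `T` is a defining system for the Massey product of `t_1, …, t_n ∈ H^1(G, R(χ))`. The indices
run from `0` to `n` instead of from `1` to `n+1`. The cochain `T_{ij}`, valued in `R(χ^{j-i})`,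
matters for `i < j` and `(i,j) ≠ (0,n)` only; the other entries of `T` are not used. -/
def IsDefiningSystem (χ : G →ₜ* Rˣ) (t : Fin n → H1 (twist χ 1))
    (T : Fin (n + 1) → Fin (n + 1) → C(G, R)) : Prop :=
  (∀ i : Fin n, (i.castSucc, i.succ) ≠ (0, Fin.last n) →
    ∃ h : T i.castSucc i.succ ∈ Z1 (twist χ 1),
      H1.mk ⟨T i.castSucc i.succ, h⟩ = t i) ∧
  ∀ i j : Fin (n + 1), (i : ℕ) + 1 < j → (i, j) ≠ (0, Fin.last n) →
    dOne (twist χ ((j : ℕ) - i)) (T i j) =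
      ∑ p ∈ Finset.Ioo i j, cup χ ((j : ℕ) - p) (T i p) (T p j)

/-- The cochain `∑_p T_{1,p} ∪ T_{p,n+1}`, with `p` strictly between the extreme indices. -/
def masseyCochain (χ : G →ₜ* Rˣ) (T : Fin (n + 1) → Fin (n + 1) → C(G, R)) : C(G × G, R) where
  toFun := ∑ p ∈ Finset.Ioo 0 (Fin.last n), cup χ (n - (p : ℕ)) (T 0 p) (T p (Fin.last n))
  continuous_toFun := by
    have hχ : Continuous fun g => (χ g : R) := Units.continuous_val.comp χ.continuous_toFun
    simp only [Finset.sum_fn, cup, twist_apply]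
    fun_prop

theorem IsDefiningSystem.rel {χ : G →ₜ* Rˣ} {t : Fin n → H1 (twist χ 1)}
    {T : Fin (n + 1) → Fin (n + 1) → C(G, R)} (hT : IsDefiningSystem χ t T) {i j : Fin (n + 1)}
    (hij : i < j) (hne : (i, j) ≠ (0, Fin.last n)) (g h : G) :
    T i j (g * h) = T i j g + (χ g : R) ^ ((j : ℕ) - i) * T i j h -
      ∑ p ∈ Finset.Ioo i j, T i p g * ((χ g : R) ^ ((j : ℕ) - p) * T p j h) := by
  have key : dOne (twist χ ((j : ℕ) - i)) (T i j) =
      ∑ p ∈ Finset.Ioo i j, cup χ ((j : ℕ) - p) (T i p) (T p j) := by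
    rcases (Nat.succ_le_of_lt hij : (i : ℕ) + 1 ≤ j).lt_or_eq with h1 | h1
    · exact hT.2 i j h1 hne
    · have hi : (i : ℕ) < n := by have := j.2; omega
      have e1 : i = (⟨i, hi⟩ : Fin n).castSucc := rfl
      have e2 : j = (⟨i, hi⟩ : Fin n).succ := Fin.ext h1.symm
      have hIoo : Finset.Ioo i j = ∅ := by
        ext p
        simp only [Finset.mem_Ioo, Fin.lt_def, Finset.notMem_empty, iff_false]
        omega
      obtain ⟨h2, -⟩ := hT.1 ⟨i, hi⟩ (by rw [← e1, ← e2]; exact hne)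
      rw [← e1, ← e2] at h2
      rw [hIoo, Finset.sum_empty, show (j : ℕ) - i = 1 by omega]
      exact h2
  have := congrFun key (g, h)
  simp only [dOne, cup, twist_apply, Finset.sum_apply] at this
  rw [← this]
  ring

theorem IsDefiningSystem.masseyCochain_mem {χ : G →ₜ* Rˣ} {t : Fin n → H1 (twist χ 1)}
    {T : Fin (n + 1) → Fin (n + 1) → C(G, R)} (hT : IsDefiningSystem χ t T) :
    masseyCochain χ T ∈ Z2 (twist χ n) := by
  refine funext fun ⟨g, h, k⟩ => ?_
  have hA : ∀ p ∈ Finset.Ioo (0 : Fin (n + 1)) (Fin.last n),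
      T 0 p (g * h) = T 0 p g + (χ g : R) ^ (p : ℕ) * T 0 p h -
        ∑ q ∈ Finset.Ioo 0 p, T 0 q g * ((χ g : R) ^ ((p : ℕ) - q) * T q p h) := by
    intro p hp
    rw [Finset.mem_Ioo] at hp
    simpa using hT.rel hp.1 (fun e => hp.2.ne (Prod.mk.inj e).2) g h
  have hB : ∀ p ∈ Finset.Ioo (0 : Fin (n + 1)) (Fin.last n),
      T p (Fin.last n) (h * k) = T p (Fin.last n) h +
        (χ h : R) ^ (n - (p : ℕ)) * T p (Fin.last n) k -
        ∑ q ∈ Finset.Ioo p (Fin.last n),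
          T p q h * ((χ h : R) ^ (n - (q : ℕ)) * T q (Fin.last n) k) := by
    intro p hp
    rw [Finset.mem_Ioo] at hp
    simpa using hT.rel hp.2 (fun e => hp.1.ne' (Prod.mk.inj e).1) h k
  have hswap : ∑ p ∈ Finset.Ioo (0 : Fin (n + 1)) (Fin.last n), ∑ q ∈ Finset.Ioo 0 p,
        T 0 q g * (χ g : R) ^ (n - (q : ℕ)) * T q p h * (χ h : R) ^ (n - (p : ℕ)) *
          T p (Fin.last n) k =
      ∑ p ∈ Finset.Ioo (0 : Fin (n + 1)) (Fin.last n), ∑ q ∈ Finset.Ioo p (Fin.last n),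
        T 0 p g * (χ g : R) ^ (n - (p : ℕ)) * T p q h * (χ h : R) ^ (n - (q : ℕ)) *
          T q (Fin.last n) k := by
    apply Finset.sum_comm'
    intro p q
    simp only [Finset.mem_Ioo]
    constructor
    · rintro ⟨⟨h1, h2⟩, h3, h4⟩
      exact ⟨⟨h4, h2⟩, h3, h4.trans h2⟩
    · rintro ⟨⟨h1, h2⟩, h3, h4⟩
      exact ⟨⟨h3.trans h1, h2⟩, h3, h1⟩
  simp only [dTwo, masseyCochain, ContinuousMap.coe_mk, Finset.sum_apply, cup, twist_apply,
    Pi.zero_apply]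
  simp only [map_mul, Units.val_mul, mul_pow]
  rw [Finset.mul_sum, ← Finset.sum_sub_distrib, ← Finset.sum_add_distrib,
    ← Finset.sum_sub_distrib]
  rw [← sub_self (∑ p ∈ Finset.Ioo (0 : Fin (n + 1)) (Fin.last n), ∑ q ∈ Finset.Ioo 0 p,
        T 0 q g * (χ g : R) ^ (n - (q : ℕ)) * T q p h * (χ h : R) ^ (n - (p : ℕ)) *
          T p (Fin.last n) k)]
  conv_rhs => rw [hswap]
  conv_rhs => arg 1; rw [← hswap]
  rw [← Finset.sum_sub_distrib]
  refine Finset.sum_congr rfl fun p hp => ?_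
  rw [hA p hp, hB p hp]
  rw [Finset.mem_Ioo] at hp
  have hpn : (p : ℕ) ≤ n := Nat.le_of_lt_succ p.2
  have e1 : (χ g : R) ^ n = (χ g : R) ^ (p : ℕ) * (χ g : R) ^ (n - (p : ℕ)) := by
    rw [← pow_add]; congr 1; omega
  have e2 : ∑ q ∈ Finset.Ioo 0 p,
        T 0 q g * (χ g : R) ^ (n - (q : ℕ)) * T q p h * (χ h : R) ^ (n - (p : ℕ)) *
          T p (Fin.last n) k =
      (∑ q ∈ Finset.Ioo 0 p, T 0 q g * ((χ g : R) ^ ((p : ℕ) - q) * T q p h)) *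
        ((χ g : R) ^ (n - (p : ℕ)) * (χ h : R) ^ (n - (p : ℕ)) * T p (Fin.last n) k) := by
    rw [Finset.sum_mul]
    refine Finset.sum_congr rfl fun q hq => ?_
    rw [Finset.mem_Ioo] at hq
    have hqp : (q : ℕ) < p := hq.2
    rw [show n - (q : ℕ) = ((p : ℕ) - q) + (n - p) by omega, pow_add]
    ring
  have e3 : ∑ q ∈ Finset.Ioo p (Fin.last n),
        T 0 p g * (χ g : R) ^ (n - (p : ℕ)) * T p q h * (χ h : R) ^ (n - (q : ℕ)) *
          T q (Fin.last n) k =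
      T 0 p g * (χ g : R) ^ (n - (p : ℕ)) * ∑ q ∈ Finset.Ioo p (Fin.last n),
          T p q h * ((χ h : R) ^ (n - (q : ℕ)) * T q (Fin.last n) k) := by
    rw [Finset.mul_sum]
    exact Finset.sum_congr rfl fun q _ => by ring
  rw [e2, e3, e1]
  ring

/-- The Massey product `⟨t_1, …, t_n⟩_T ∈ H^2(G, R(χ^n))` relative to the defining system `T`. -/
def massey {χ : G →ₜ* Rˣ} {t : Fin n → H1 (twist χ 1)}
    {T : Fin (n + 1) → Fin (n + 1) → C(G, R)} (hT : IsDefiningSystem χ t T) :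
    H2 (twist χ n) :=
  H2.mk ⟨masseyCochain χ T, hT.masseyCochain_mem⟩

end Massey

/-! ### The boundary map of a central extension -/

section Boundary

open scoped IsMulCommutative

variable {G : Type*} [Group G] [TopologicalSpace G] {E Q : Type*} [Group E] [TopologicalSpace E]
  [Group Q] [TopologicalSpace Q]

/-- A `G`-equivariant central extension `1 → K → E → Q → 1` of topological groups, with `K` a
subgroup of `E`, whose projection has a continuous section (not a homomorphism). -/
structure CentralExt (ρE : G →* Monoid.End E) (ρQ : G →* Monoid.End Q) (K : Subgroup E) where
  proj : E →* Q
  continuous_proj : Continuous proj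
  ker_proj : proj.ker = K
  central : K ≤ Subgroup.center E
  equivariant : ∀ g e, proj (ρE g e) = ρQ g (proj e)
  continuous_act : Continuous fun p : G × E => ρE p.1 p.2
  exists_section : ∃ σ : Q → E, Continuous σ ∧ ∀ q, proj (σ q) = q

namespace CentralExt

variable {ρE : G →* Monoid.End E} {ρQ : G →* Monoid.End Q} {K : Subgroup E}
  (X : CentralExt ρE ρQ K)

theorem act_mem (X : CentralExt ρE ρQ K) (g : G) {e : E} (he : e ∈ K) : ρE g e ∈ K := by
  rw [← X.ker_proj, MonoidHom.mem_ker] at he ⊢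
  rw [X.equivariant, he, map_one]

theorem comm (X : CentralExt ρE ρQ K) {k : E} (hk : k ∈ K) (e : E) : e * k = k * e :=
  Subgroup.mem_center_iff.1 (X.central hk) e

theorem mem_of_proj_eq (X : CentralExt ρE ρQ K) {a b : E} (h : X.proj a = X.proj b) :
    a * b⁻¹ ∈ K := by
  rw [← X.ker_proj, MonoidHom.mem_ker, map_mul, map_inv, h, mul_inv_cancel]

/-- The action of `G` on the kernel `K` by restriction, written additively. -/
def coeff : G →* AddMonoid.End (Additive K) where
  toFun g := MonoidHom.toAdditive
    (((ρE g : E →* E).comp K.subtype).codRestrict K fun k => X.act_mem g k.2)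
  map_one' := by
    ext k
    change (ρE 1) k.toMul.1 = k.toMul.1
    rw [map_one]; rfl
  map_mul' g h := by
    ext k
    change (ρE (g * h)) k.toMul.1 = ρE g (ρE h k.toMul.1)
    rw [map_mul]; rfl

theorem coe_coeff (g : G) (k : Additive K) : ((X.coeff g k).toMul : E) = ρE g k.toMul := rfl

theorem exists_lift (X : CentralExt ρE ρQ K) (x : Cocycle ρQ) :
    ∃ y : C(G, E), ∀ g, X.proj (y g) = x.1 g := by
  obtain ⟨σ, hσ, h⟩ := X.exists_section
  exact ⟨⟨fun g => σ (x.1 g), hσ.comp x.1.continuous⟩, fun g => h _⟩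

theorem lift_mem (X : CentralExt ρE ρQ K) {x : Cocycle ρQ} {y : C(G, E)}
    (hy : ∀ g, X.proj (y g) = x.1 g) (g h : G) :
    y g * ρE g (y h) * (y (g * h))⁻¹ ∈ K := by
  apply X.mem_of_proj_eq
  rw [map_mul, X.equivariant, hy, hy, hy, x.2]

variable [IsTopologicalGroup G] [IsTopologicalGroup E]

/-- The `2`-cochain `(g, h) ↦ y(g) g(y(h)) y(gh)⁻¹` with values in `K`, for a continuous lift
`y : G → E` of the cocycle `x : G → Q`. -/
def liftCochain {x : Cocycle ρQ} {y : C(G, E)} (hy : ∀ g, X.proj (y g) = x.1 g) :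
    C(G × G, Additive K) where
  toFun p := Additive.ofMul ⟨y p.1 * ρE p.1 (y p.2) * (y (p.1 * p.2))⁻¹, X.lift_mem hy p.1 p.2⟩
  continuous_toFun := by
    refine continuous_ofMul.comp (Continuous.subtype_mk ?_ _)
    have h1 : Continuous fun p : G × G => ρE p.1 (y p.2) :=
      X.continuous_act.comp (continuous_fst.prodMk (y.continuous.comp continuous_snd))
    exact ((y.continuous.comp continuous_fst).mul h1).mul
      (y.continuous.comp (continuous_fst.mul continuous_snd)).inv

theorem coe_liftCochain {x : Cocycle ρQ} {y : C(G, E)} (hy : ∀ g, X.proj (y g) = x.1 g)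
    (p : G × G) : ((X.liftCochain hy p).toMul : E) =
      y p.1 * ρE p.1 (y p.2) * (y (p.1 * p.2))⁻¹ := rfl

variable [IsMulCommutative K]

theorem liftCochain_mem {x : Cocycle ρQ} {y : C(G, E)} (hy : ∀ g, X.proj (y g) = x.1 g) :
    X.liftCochain hy ∈ Z2 X.coeff := by
  refine funext fun ⟨g, h, k⟩ => ?_
  have key : X.coeff g (X.liftCochain hy (h, k)) + X.liftCochain hy (g, h * k) =
      X.liftCochain hy (g, h) + X.liftCochain hy (g * h, k) := by
    refine Additive.toMul.injective (Subtype.ext ?_)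
    change ρE g (X.liftCochain hy (h, k)).toMul.1 * (X.liftCochain hy (g, h * k)).toMul.1 =
      (X.liftCochain hy (g, h)).toMul.1 * (X.liftCochain hy (g * h, k)).toMul.1
    have hc := X.comm (X.act_mem g (X.liftCochain hy (h, k)).toMul.2) (y g)
    simp only [coe_liftCochain] at hc ⊢
    have e1 : ∀ a b c : E, a * b = b * a → b * (a * c) = a * (b * c) := by
      intro a b c hab
      rw [← mul_assoc, ← hab, mul_assoc]
    rw [mul_assoc (y g), e1 _ _ _ hc]
    have e2 : ρE (g * h) (y k) = ρE g (ρE h (y k)) := by rw [map_mul]; rfl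
    simp only [map_mul, map_inv]
    rw [← map_mul ρE, e2]
    simp only [mul_assoc, inv_mul_cancel_left]
  simp only [dTwo, Pi.zero_apply]
  rw [sub_add_eq_add_sub, key]
  abel

theorem liftCochain_sub_mem {x x' : Cocycle ρQ} {y y' : C(G, E)}
    (hy : ∀ g, X.proj (y g) = x.1 g) (hy' : ∀ g, X.proj (y' g) = x'.1 g)
    (h : (Cocycle.setoid ρQ).r x x') :
    -X.liftCochain hy + X.liftCochain hy' ∈ B2 X.coeff := by
  obtain ⟨q, hq⟩ := h
  obtain ⟨σ, -, hσ⟩ := X.exists_section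
  set e := σ q with he
  have hp : X.proj e = q := hσ q
  have hz : ∀ g, X.proj (y' g) = X.proj (e⁻¹ * y g * ρE g e) := fun g => by
    rw [hy', hq, map_mul, map_mul, map_inv, X.equivariant, hp, hy]
  have hcont : Continuous fun g => y' g * (e⁻¹ * y g * ρE g e)⁻¹ := by
    have h1 : Continuous fun g : G => ρE g e :=
      X.continuous_act.comp (continuous_id.prodMk continuous_const)
    exact y'.continuous.mul ((continuous_const.mul y.continuous).mul h1).inv
  let b : C(G, Additive K) := ⟨fun g => Additive.ofMul
    ⟨y' g * (e⁻¹ * y g * ρE g e)⁻¹, X.mem_of_proj_eq (hz g)⟩,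
    continuous_ofMul.comp (Continuous.subtype_mk hcont _)⟩
  have hb : ∀ g, y' g = (b g).toMul.1 * (e⁻¹ * y g * ρE g e) := fun g => by
    change _ = y' g * (e⁻¹ * y g * ρE g e)⁻¹ * (e⁻¹ * y g * ρE g e)
    rw [inv_mul_cancel_right]
  have hy2 : ∀ g h, y g * ρE g (y h) = (X.liftCochain hy (g, h)).toMul.1 * y (g * h) :=
    fun g h => by rw [coe_liftCochain, inv_mul_cancel_right]
  refine ⟨b, funext fun ⟨g, h⟩ => ?_⟩
  have key : X.liftCochain hy' (g, h) + b (g * h) =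
      X.liftCochain hy (g, h) + (X.coeff g (b h) + b g) := by
    refine Additive.toMul.injective (Subtype.ext ?_)
    change (X.liftCochain hy' (g, h)).toMul.1 * (b (g * h)).toMul.1 =
      (X.liftCochain hy (g, h)).toMul.1 * (ρE g (b h).toMul.1 * (b g).toMul.1)
    have c2 := fun z => X.comm (X.act_mem g (b h).toMul.2) z
    have c4 := fun z => X.comm (X.liftCochain hy (g, h)).toMul.2 z
    have e2 : ρE (g * h) e = ρE g (ρE h e) := by rw [map_mul]; rfl
    have main : y' g * ρE g (y' h) =
        (X.liftCochain hy (g, h)).toMul.1 * (ρE g (b h).toMul.1 * (b g).toMul.1) *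
          (e⁻¹ * y (g * h) * ρE (g * h) e) := by
      calc y' g * ρE g (y' h)
          = (b g).toMul.1 * (e⁻¹ * y g * ρE g e * ρE g (b h).toMul.1) *
              ((ρE g e)⁻¹ * ρE g (y h) * ρE g (ρE h e)) := by
            rw [hb g, hb h]; simp only [map_mul, map_inv, mul_assoc]
        _ = (b g).toMul.1 * ρE g (b h).toMul.1 *
              (e⁻¹ * (y g * ρE g (y h)) * ρE g (ρE h e)) := by
            rw [c2]; simp only [mul_assoc, mul_inv_cancel_left]
        _ = (b g).toMul.1 * ρE g (b h).toMul.1 *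
              (e⁻¹ * (X.liftCochain hy (g, h)).toMul.1 * y (g * h) * ρE g (ρE h e)) := by
            rw [hy2]; simp only [mul_assoc]
        _ = (b g).toMul.1 * ρE g (b h).toMul.1 * (X.liftCochain hy (g, h)).toMul.1 *
              (e⁻¹ * y (g * h) * ρE g (ρE h e)) := by
            rw [c4]; simp only [mul_assoc]
        _ = _ := by
            rw [c4 ((b g).toMul.1 * ρE g (b h).toMul.1), c2 (b g).toMul.1, e2]
    rw [coe_liftCochain, main, hb (g * h)]
    group
  have hfin : X.liftCochain hy' (g, h) =
      X.liftCochain hy (g, h) + (X.coeff g (b h) + b g) - b (g * h) := by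
    rw [← key, add_sub_cancel_right]
  change -X.liftCochain hy (g, h) + X.liftCochain hy' (g, h) = dOne X.coeff b (g, h)
  rw [hfin, dOne]
  abel

/-- The boundary map `δ : H^1(G, Q) → H^2(G, K)` of the central extension: the class of the
cocycle `x` goes to the class of `(g, h) ↦ y(g) g(y(h)) y(gh)⁻¹`, where `y` is any continuous
lift of `x`. -/
noncomputable def delta : NonabH1 ρQ → H2 X.coeff :=
  Quotient.lift (s := Cocycle.setoid ρQ)
    (fun x => H2.mk ⟨X.liftCochain (X.exists_lift x).choose_spec, X.liftCochain_mem _⟩)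
    (fun x x' h => QuotientAddGroup.eq.2 (AddSubgroup.mem_addSubgroupOf.2
      (X.liftCochain_sub_mem (X.exists_lift x).choose_spec (X.exists_lift x').choose_spec h)))

theorem delta_mk (x : Cocycle ρQ) (y : C(G, E)) (hy : ∀ g, X.proj (y g) = x.1 g) :
    X.delta (NonabH1.mk x) =
      H2.mk ⟨X.liftCochain hy, X.liftCochain_mem hy⟩ :=
  QuotientAddGroup.eq.2 (AddSubgroup.mem_addSubgroupOf.2
    (X.liftCochain_sub_mem (X.exists_lift x).choose_spec hy ((Cocycle.setoid ρQ).iseqv.refl x)))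

end CentralExt

end Boundary

/-! ### The free pro-`S` group with action through a character -/

section Main

variable {S : Set ℕ} {r : ℕ} {G : Type*} [Group G] [TopologicalSpace G]

/-- The action of `G` on the free pro-`S` group `π` with `g γ_i = γ_i ^ χ(g)`. -/
noncomputable def act (r : ℕ) (χ : G →ₜ* (ZSigma S)ˣ) : G →* Monoid.End (FreePro S r) :=
  (powEnd S r).comp ((Units.coeHom (ZSigma S)).comp χ.toMonoidHom)

theorem act_gen (χ : G →ₜ* (ZSigma S)ˣ) (g : G) (i : Fin r) :
    act r χ g (gen i) = spow (gen i) (χ g : ZSigma S) := powEnd_gen _ i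

theorem continuous_act (χ : G →ₜ* (ZSigma S)ˣ) :
    Continuous fun p : G × FreePro S r => act r χ p.1 p.2 := by
  have h1 : Continuous fun p : G × FreePro S r => ((χ p.1 : ZSigma S), p.2) :=
    ((Units.continuous_val.comp χ.continuous_toFun).comp continuous_fst).prodMk continuous_snd
  have h2 : (fun p : G × FreePro S r => act r χ p.1 p.2) =
      (fun p : ZSigma S × FreePro S r => powEnd S r p.1 p.2) ∘
        fun p : G × FreePro S r => ((χ p.1 : ZSigma S), p.2) := by
    funext p
    simp only [Function.comp_apply, act, MonoidHom.comp_apply, Units.coeHom_apply]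
    rfl
  rw [h2]
  exact (continuous_powEnd r).comp h1

variable (S r) in
/-- The quotient `π/[π]_k` of the free pro-`S` group `π`. -/
abbrev LcsQuot (k : ℕ) : Type := FreePro S r ⧸ lcs (FreePro S r) k

variable (r) in
/-- The action of `G` on `π/[π]_k` induced by the action on `π`. -/
noncomputable def quotAct (χ : G →ₜ* (ZSigma S)ˣ) (k : ℕ) :
    G →* Monoid.End (LcsQuot S r k) where
  toFun g := QuotientGroup.map _ _ (act r χ g) (lcs_le_comap _
    ((continuous_act χ).comp (continuous_const.prodMk continuous_id)) k)
  map_one' := by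
    refine QuotientGroup.monoidHom_ext _ (MonoidHom.ext fun w => ?_)
    change ((act r χ 1 w : FreePro S r) : LcsQuot S r k) = w
    rw [map_one]; rfl
  map_mul' g h := by
    refine QuotientGroup.monoidHom_ext _ (MonoidHom.ext fun w => ?_)
    change ((act r χ (g * h) w : FreePro S r) : LcsQuot S r k) =
      ((act r χ g (act r χ h w) : FreePro S r) : LcsQuot S r k)
    rw [map_mul]; rfl

theorem quotAct_mk (χ : G →ₜ* (ZSigma S)ˣ) (k : ℕ) (g : G) (w : FreePro S r) :
    quotAct r χ k g (w : LcsQuot S r k) = (act r χ g w : FreePro S r) := rfl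

theorem continuous_quotAct (χ : G →ₜ* (ZSigma S)ˣ) (k : ℕ) :
    Continuous fun p : G × LcsQuot S r k => quotAct r χ k p.1 p.2 := by
  have hq : IsOpenQuotientMap (Prod.map id ((↑) : FreePro S r → LcsQuot S r k) :
      G × FreePro S r → G × LcsQuot S r k) :=
    IsOpenQuotientMap.id.prodMap QuotientGroup.isOpenQuotientMap_mk
  rw [← hq.continuous_comp_iff]
  exact continuous_quotient_mk'.comp (continuous_act χ)

variable (S r) in
/-- The projection `π/[π]_k → π/[π]_l` for `l ≤ k`. -/
def lcsProj {k l : ℕ} (h : l ≤ k) : LcsQuot S r k →* LcsQuot S r l :=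
  QuotientGroup.map _ _ (MonoidHom.id _) (lcs_antitone h)

theorem continuous_lcsProj {k l : ℕ} (h : l ≤ k) : Continuous (lcsProj S r h) :=
  continuous_quot_lift _ continuous_quotient_mk'

variable (S r) in
/-- The group `[π]_n/[π]_{n+1}`, as a subgroup of `π/[π]_{n+1}`. -/
def gradedPiece (n : ℕ) : Subgroup (LcsQuot S r (n + 1)) :=
  (lcs (FreePro S r) n).map (QuotientGroup.mk' (lcs (FreePro S r) (n + 1)))

theorem gradedPiece_le_center (n : ℕ) :
    gradedPiece S r n ≤ Subgroup.center (LcsQuot S r (n + 1)) := by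
  rintro _ ⟨w, hw, rfl⟩
  refine Subgroup.mem_center_iff.2 fun e => ?_
  obtain ⟨v, rfl⟩ := QuotientGroup.mk_surjective e
  have h := commutator_lcs_le n (Subgroup.commutator_mem_commutator
    (Subgroup.mem_top v⁻¹) ((lcs (FreePro S r) n).inv_mem hw))
  refine (QuotientGroup.eq.2 ?_).symm
  have h' : v⁻¹ * w⁻¹ * v⁻¹⁻¹ * w⁻¹⁻¹ ∈ lcs (FreePro S r) (n + 1) := h
  have e : (w * v)⁻¹ * (v * w) = v⁻¹ * w⁻¹ * v⁻¹⁻¹ * w⁻¹⁻¹ := by group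
  change (w * v)⁻¹ * (v * w) ∈ _
  rw [e]; exact h'

instance (n : ℕ) : IsMulCommutative (gradedPiece S r n) :=
  IsMulCommutative.of_comm fun a b => Subtype.ext
    ((Subgroup.mem_center_iff.1 (gradedPiece_le_center n b.2) a.1))

variable (r) in
/-- The `G`-equivariant central extension
`1 → [π]_n/[π]_{n+1} → π/[π]_{n+1} → π/[π]_n → 1`. -/
noncomputable def lcsExt (χ : G →ₜ* (ZSigma S)ˣ) (n : ℕ) :
    CentralExt (quotAct r χ (n + 1)) (quotAct r χ n) (gradedPiece S r n) where
  proj := lcsProj S r (Nat.le_succ n)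
  continuous_proj := continuous_lcsProj _
  ker_proj := by
    ext e
    obtain ⟨w, rfl⟩ := QuotientGroup.mk_surjective e
    have h1 : (w : LcsQuot S r (n + 1)) ∈ (lcsProj S r (Nat.le_succ n)).ker ↔
        w ∈ lcs (FreePro S r) n := QuotientGroup.eq_one_iff (N := lcs (FreePro S r) n) w
    rw [h1]
    constructor
    · intro h
      exact ⟨w, h, rfl⟩
    · rintro ⟨v, hv, hvw⟩
      have h2 : v⁻¹ * w ∈ lcs (FreePro S r) (n + 1) := QuotientGroup.eq.1 hvw
      simpa using mul_mem hv (lcs_succ_le n h2)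
  central := gradedPiece_le_center n
  equivariant g e := by
    obtain ⟨w, rfl⟩ := QuotientGroup.mk_surjective e
    rfl
  continuous_act := continuous_quotAct χ (n + 1)
  exists_section := by
    obtain ⟨σ, hσ, h⟩ := exists_continuous_section (lcs (FreePro S r) n) (isClosed_lcs n)
    exact ⟨fun q => (σ q : LcsQuot S r (n + 1)), continuous_quotient_mk'.comp hσ, h⟩

open scoped IsMulCommutative in
variable (r) in
/-- The boundary map `δ_n : H^1(G, π/[π]_n) → H^2(G, [π]_n/[π]_{n+1})`. -/
noncomputable def deltaN [IsTopologicalGroup G] (χ : G →ₜ* (ZSigma S)ˣ) (n : ℕ) :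
    NonabH1 (quotAct r χ n) → H2 (lcsExt r χ n).coeff :=
  (lcsExt r χ n).delta

theorem lcs_two_le_ker (i : Fin r) : lcs (FreePro S r) 2 ≤ (coord i).ker := by
  refine Subgroup.topologicalClosure_minimal _ ?_ ?_
  · rw [Subgroup.commutator_le]
    intro v _ w _
    rw [MonoidHom.mem_ker, map_commutatorElement, commutatorElement_eq_one_iff_mul_comm, mul_comm]
  · change IsClosed {w : FreePro S r | (coord i w).toAdd = (0 : ZSigma S)}
    exact isClosed_eq (continuous_coord i) continuous_const

/-- The `i`-th coordinate of the isomorphism `π/[π]_2 ≅ (ℤ^S)^r` given by `γ_1, …, γ_r`. -/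
noncomputable def coordAb (i : Fin r) : LcsQuot S r 2 →* Multiplicative (ZSigma S) :=
  QuotientGroup.lift _ (coord i) (lcs_two_le_ker i)

/-- The cocycle `G → ℤ^S(χ)` obtained from `x : G → π/[π]_n`, `n ≥ 2`, by projecting to
`π/[π]_2` and taking the `i`-th coordinate. -/
noncomputable def abCocycle (χ : G →ₜ* (ZSigma S)ˣ) {n : ℕ} (hn : 2 ≤ n)
    (x : Cocycle (quotAct r χ n)) (i : Fin r) : Z1 (twist χ 1) :=
  ⟨⟨fun g => (coordAb i (lcsProj S r hn (x.1 g))).toAdd,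
    (show Continuous fun q : LcsQuot S r 2 => (coordAb i q).toAdd from
      continuous_quot_lift _ (continuous_coord i)).comp
        ((continuous_lcsProj hn).comp x.1.continuous)⟩, by
    refine funext fun ⟨g, h⟩ => ?_
    have key : ∀ q : LcsQuot S r n, (coordAb i (lcsProj S r hn (quotAct r χ n g q))).toAdd =
        (χ g : ZSigma S) * (coordAb i (lcsProj S r hn q)).toAdd := by
      intro q
      obtain ⟨w, rfl⟩ := QuotientGroup.mk_surjective q
      exact coord_powEnd i (χ g : ZSigma S) w
    have e : x.1 (g * h) = x.1 g * quotAct r χ n g (x.1 h) := x.2 g h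
    simp only [dOne, twist_apply, ContinuousMap.coe_mk, Pi.zero_apply, pow_one]
    rw [e, map_mul, map_mul, toAdd_mul, key]
    abel⟩

open Classical in
/-- The class `x_i ∈ H^1(G, ℤ^S(χ))` of a cocycle `x : G → π/[π]_n`. It is of interest for
`n ≥ 2`; for `n ≤ 1` the group `π/[π]_n` is trivial, and `x_i` is `0`. -/
noncomputable def abClass (χ : G →ₜ* (ZSigma S)ˣ) {n : ℕ} (x : Cocycle (quotAct r χ n))
    (i : Fin r) : H1 (twist χ 1) :=
  if hn : 2 ≤ n then H1.mk (abCocycle χ hn x i) else 0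

theorem lcs_le_comap_phi {n : ℕ} (J : Fin n → Fin r) (k : ℕ) :
    lcs (FreePro S r) k ≤ (Unip.filt k).comap (phi J) := by
  refine lcs_le_of_closed (fun k => (Unip.filt k).comap (phi J)) (fun k => ?_)
    (by rw [Unip.filt_zero]; rfl) (by rw [Unip.filt_one]; rfl) (fun k => ?_) k
  · have : (((Unip.filt k).comap (phi J) : Subgroup (FreePro S r)) : Set (FreePro S r)) =
        ⋂ (i : Fin (n + 1)), ⋂ (j : Fin (n + 1)), ⋂ (_ : (j : ℕ) < i + k),
          {w | Unip.entry i j (phi J w) -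
            (1 : Matrix (Fin (n + 1)) (Fin (n + 1)) (ZSigma S)) i j = 0} := by
      ext w; simp only [Set.mem_iInter]; rfl
    rw [this]
    exact isClosed_iInter fun i => isClosed_iInter fun j => isClosed_iInter fun _ =>
      isClosed_eq ((continuous_entry_phi J i j).sub continuous_const) continuous_const
  · rw [← Subgroup.map_le_iff_le_comap, Subgroup.map_commutator]
    exact (Subgroup.commutator_mono le_top (Subgroup.map_comap_le _ _)).trans
      (Unip.commutator_filt_le k)

/-- The homomorphism `π/[π]_n → Ū_{n+1}` induced by `φ_J`. -/
noncomputable def phiBar {n : ℕ} (J : Fin n → Fin r) :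
    LcsQuot S r n →* UnipBar (ZSigma S) n :=
  QuotientGroup.map _ _ (phi J) (by rw [Unip.corner_eq]; exact lcs_le_comap_phi J n)

theorem continuous_entry_phiBar {n : ℕ} (J : Fin n → Fin r) (i j : Fin (n + 1)) :
    Continuous fun q : LcsQuot S r n => UnipBar.entry i j (phiBar J q) := by
  refine (QuotientGroup.isOpenQuotientMap_mk).continuous_comp_iff.1 ?_
  by_cases h : (i, j) = (0, Fin.last n)
  · simp only [UnipBar.entry, dif_pos h]
    exact continuous_const
  · refine (continuous_entry_phi J i j).congr fun w => ?_
    exact (UnipBar.entry_mk h (phi J w)).symm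

/-- The cochains `-a_{ij} φ_J x`. -/
noncomputable def phiSystem (χ : G →ₜ* (ZSigma S)ˣ) {n : ℕ} (x : Cocycle (quotAct r χ n))
    (J : Fin n → Fin r) (i j : Fin (n + 1)) : C(G, ZSigma S) :=
  ⟨fun g => -UnipBar.entry i j (phiBar J (x.1 g)),
    ((continuous_entry_phiBar J i j).comp x.1.continuous).neg⟩

end Main

/-- The set of primes that do not divide `n!`. -/
def primesNotDvdFactorial (n : ℕ) : Set ℕ := {p | p.Prime ∧ ¬ p ∣ Nat.factorial n}

/-- The factorials `l!` with `l ≤ n` are units of `ℤ^Σ`, where `Σ` is the set of primes that do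
not divide `n!`. -/
theorem isUnit_factorial {n l : ℕ} (hl : l ≤ n) :
    IsUnit ((Nat.factorial l : ℕ) : ZSigma (primesNotDvdFactorial n)) := by
  have hu : ∀ m : {m : ℕ // IsSigmaNumber (primesNotDvdFactorial n) m},
      IsUnit ((Nat.factorial l : ℕ) : ZMod m.1) := fun m => by
    rw [ZMod.isUnit_iff_coprime]
    refine Nat.Coprime.symm (Nat.coprime_of_dvd fun p hp hpm hpl => ?_)
    exact (m.2.2 p hp hpm).2 (hpl.trans (Nat.factorial_dvd_factorial hl))
  refine IsUnit.of_mul_eq_one ⟨fun m => ((hu m).unit⁻¹ : (ZMod m.1)ˣ), fun m m' h => ?_⟩ ?_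
  · refine (hu m).mul_left_cancel ?_
    rw [IsUnit.mul_val_inv]
    rw [← map_natCast (ZMod.castHom h (ZMod m.1)), ← map_mul, IsUnit.mul_val_inv, map_one]
  · exact Subtype.ext (funext fun m => (hu m).mul_val_inv)

end DeltaMassey

open DeltaMassey

namespace DeltaMassey

open scoped commutatorElement

/-! ### Commutators of the terms of the lower central series -/

section Commutators

/-- The three subgroups lemma modulo a normal subgroup. -/
theorem commutator_commutator_le_of_rotate {P : Type*} [Group P] {N H₁ H₂ H₃ : Subgroup P}
    [N.Normal] (h₁ : ⁅⁅H₂, H₃⁆, H₁⁆ ≤ N) (h₂ : ⁅⁅H₃, H₁⁆, H₂⁆ ≤ N) : ⁅⁅H₁, H₂⁆, H₃⁆ ≤ N := by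
  have key : ∀ H : Subgroup P, H ≤ N ↔ H.map (QuotientGroup.mk' N) = ⊥ := fun H => by
    rw [Subgroup.map_eq_bot_iff, QuotientGroup.ker_mk']
  rw [key] at h₁ h₂ ⊢
  simp only [Subgroup.map_commutator] at h₁ h₂ ⊢
  exact Subgroup.commutator_commutator_eq_bot_of_rotate h₁ h₂

/-- The Jacobi identity for group commutators, under the commutation relations that hold in
the top degree of a nilpotent group. -/
theorem commutatorElement_jacobi {P : Type*} [Group P] {a b z : P}
    (h₁ : Commute ⁅a, b⁆ ⁅b * a, z⁆) (h₂ : Commute ⁅a, z⁆ ⁅b, z⁆)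
    (h₃ : ∀ w, Commute ⁅⁅a, b⁆, z⁆ w) : ⁅⁅a, b⁆, z⁆ * ⁅b, ⁅a, z⁆⁆ = ⁅a, ⁅b, z⁆⁆ := by
  have e : ∀ x y : P, ⁅x * y, z⁆ = ⁅x, ⁅y, z⁆⁆ * ⁅y, z⁆ * ⁅x, z⁆ := fun x y => by
    simp only [commutatorElement_def]; group
  have h₄ : ⁅a * b, z⁆ = ⁅b * a, z⁆ * ⁅⁅a, b⁆, z⁆ := by
    have : a * b = ⁅a, b⁆ * (b * a) := by simp only [commutatorElement_def]; group
    rw [this, e, commutatorElement_eq_one_iff_commute.2 h₁, one_mul]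
  rw [e, e, mul_assoc _ ⁅a, z⁆, h₂.eq, mul_assoc, ← (h₃ _).eq, ← mul_assoc, ← mul_assoc] at h₄
  rw [mul_assoc ⁅a, ⁅b, z⁆⁆] at h₄
  exact (mul_right_cancel h₄).symm

variable {P : Type*} [Group P] [TopologicalSpace P] [IsTopologicalGroup P]

theorem commutator_lcs_lcs_le (p q : ℕ) : ⁅lcs P p, lcs P q⁆ ≤ lcs P (p + q) := by
  induction p generalizing q with
  | zero => rw [zero_add]; exact Subgroup.commutator_le_right _ _
  | succ p ih =>
    rcases p with _ | p
    · rw [zero_add, add_comm]; exact commutator_lcs_le q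
    have h : ⁅⁅(⊤ : Subgroup P), lcs P (p + 1)⁆, lcs P q⁆ ≤ lcs P (p + 1 + 1 + q) := by
      apply commutator_commutator_le_of_rotate
      · rw [Subgroup.commutator_comm]
        refine (Subgroup.commutator_mono le_rfl (ih q)).trans ?_
        rw [show p + 1 + 1 + q = p + 1 + q + 1 by omega]
        exact commutator_lcs_le _
      · rw [Subgroup.commutator_comm, Subgroup.commutator_comm (lcs P q)]
        refine (Subgroup.commutator_mono le_rfl (commutator_lcs_le q)).trans ?_
        rw [show p + 1 + 1 + q = p + 1 + (q + 1) by omega]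
        exact ih (q + 1)
    rw [Subgroup.commutator_le] at h ⊢
    intro w hw z hz
    have hc : IsClosed {w : P | ⁅w, z⁆ ∈ lcs P (p + 1 + 1 + q)} := by
      simp only [commutatorElement_def]
      exact (isClosed_lcs _).preimage (by fun_prop)
    exact closure_minimal (fun v hv => h v hv z hz) hc hw

theorem commutator_mem_lcs {p q N : ℕ} {a b : P} (ha : a ∈ lcs P p) (hb : b ∈ lcs P q)
    (h : N ≤ p + q) : ⁅a, b⁆ ∈ lcs P N :=
  lcs_antitone h (commutator_lcs_lcs_le p q (Subgroup.commutator_mem_commutator ha hb))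

theorem mem_lcs_one (a : P) : a ∈ lcs P 1 := Subgroup.mem_top a

theorem commutator_mem_lcs_succ {q : ℕ} (a : P) {b : P} (hb : b ∈ lcs P q) :
    ⁅a, b⁆ ∈ lcs P (q + 1) :=
  commutator_mem_lcs (mem_lcs_one a) hb (by omega)

end Commutators

/-! ### The associated graded Lie ring of the lower central series -/

section Graded

open scoped IsMulCommutative

variable {S : Set ℕ} {r : ℕ}

open Classical in
/-- The class in `[π]_N/[π]_{N+1}` of an element of `[π]_N`. For elements outside `[π]_N`, it is
given the value `0`. -/
noncomputable def grClass (N : ℕ) (w : FreePro S r) : Additive (gradedPiece S r N) :=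
  if h : w ∈ lcs (FreePro S r) N then Additive.ofMul ⟨(w : LcsQuot S r (N + 1)), w, h, rfl⟩ else 0

theorem coe_grClass {N : ℕ} {w : FreePro S r} (h : w ∈ lcs (FreePro S r) N) :
    ((grClass N w).toMul : LcsQuot S r (N + 1)) = w := by
  rw [grClass, dif_pos h]; rfl

theorem grClass_surjective {N : ℕ} (k : Additive (gradedPiece S r N)) :
    ∃ w ∈ lcs (FreePro S r) N, grClass N w = k := by
  obtain ⟨w, hw, h⟩ := k.toMul.2
  exact ⟨w, hw, Additive.toMul.injective (Subtype.ext ((coe_grClass hw).trans h))⟩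

theorem grClass_eq_iff {N : ℕ} {w v : FreePro S r} (hw : w ∈ lcs (FreePro S r) N)
    (hv : v ∈ lcs (FreePro S r) N) :
    grClass N w = grClass N v ↔ (w : LcsQuot S r (N + 1)) = v := by
  rw [← coe_grClass hw, ← coe_grClass hv, SetLike.coe_eq_coe, Equiv.apply_eq_iff_eq]

theorem grClass_mul {N : ℕ} {w v : FreePro S r} (hw : w ∈ lcs (FreePro S r) N)
    (hv : v ∈ lcs (FreePro S r) N) : grClass N (w * v) = grClass N w + grClass N v := by
  refine Additive.toMul.injective (Subtype.ext ?_)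
  change _ = ((grClass N w).toMul : LcsQuot S r (N + 1)) * (grClass N v).toMul
  rw [coe_grClass hw, coe_grClass hv, coe_grClass (mul_mem hw hv)]; rfl

theorem grClass_inv {N : ℕ} {w : FreePro S r} (hw : w ∈ lcs (FreePro S r) N) :
    grClass N w⁻¹ = -grClass N w := by
  refine Additive.toMul.injective (Subtype.ext ?_)
  change _ = ((grClass N w).toMul : LcsQuot S r (N + 1))⁻¹
  rw [coe_grClass hw, coe_grClass (inv_mem hw)]; rfl

theorem grClass_of_mem_succ {N : ℕ} {w : FreePro S r} (hw : w ∈ lcs (FreePro S r) (N + 1)) :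
    grClass N w = 0 :=
  Additive.toMul.injective (Subtype.ext ((coe_grClass (lcs_succ_le N hw)).trans
    ((QuotientGroup.eq_one_iff w).2 hw)))

theorem grClass_pow {N : ℕ} {w : FreePro S r} (hw : w ∈ lcs (FreePro S r) N) (e : ℕ) :
    grClass N (w ^ e) = e • grClass N w := by
  induction e with
  | zero => rw [pow_zero, zero_smul]; exact grClass_of_mem_succ (one_mem _)
  | succ e ih => rw [pow_succ, grClass_mul (pow_mem hw e) hw, ih, succ_nsmul]

theorem grClass_commutator_mul {q : ℕ} (a : FreePro S r) {w v : FreePro S r}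
    (hw : w ∈ lcs (FreePro S r) q) (hv : v ∈ lcs (FreePro S r) q) :
    grClass (q + 1) ⁅a, w * v⁆ = grClass (q + 1) ⁅a, w⁆ + grClass (q + 1) ⁅a, v⁆ := by
  have e : ⁅a, w * v⁆ = ⁅a, w⁆ * ⁅w, ⁅a, v⁆⁆ * ⁅a, v⁆ := by
    simp only [commutatorElement_def]; group
  have h₁ := commutator_mem_lcs_succ a hw
  have h₂ := commutator_mem_lcs_succ a hv
  have h₃ := commutator_mem_lcs_succ w h₂
  rw [e, grClass_mul (mul_mem h₁ (lcs_succ_le _ h₃)) h₂, grClass_mul h₁ (lcs_succ_le _ h₃),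
    grClass_of_mem_succ h₃, add_zero]

theorem grClass_commutator_congr {q : ℕ} (a : FreePro S r) {w v : FreePro S r}
    (hw : w ∈ lcs (FreePro S r) q) (hv : v ∈ lcs (FreePro S r) q)
    (h : grClass q w = grClass q v) : grClass (q + 1) ⁅a, w⁆ = grClass (q + 1) ⁅a, v⁆ := by
  rw [grClass_eq_iff hw hv, QuotientGroup.eq] at h
  have e : v = w * (w⁻¹ * v) := by group
  rw [e, grClass_commutator_mul a hw (lcs_succ_le _ h),
    grClass_of_mem_succ (commutator_mem_lcs_succ a h), add_zero]

/-- The map `[π]_q/[π]_{q+1} → [π]_{q+1}/[π]_{q+2}` induced by the commutator with `a`. -/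
noncomputable def grAd (q : ℕ) (a : FreePro S r) :
    Additive (gradedPiece S r q) →+ Additive (gradedPiece S r (q + 1)) :=
  AddMonoidHom.mk' (fun k => grClass (q + 1) ⁅a, (grClass_surjective k).choose⁆) (fun k l => by
    have h₁ := (grClass_surjective k).choose_spec
    have h₂ := (grClass_surjective l).choose_spec
    have h₃ := (grClass_surjective (k + l)).choose_spec
    rw [← grClass_commutator_mul a h₁.1 h₂.1]
    refine grClass_commutator_congr a h₃.1 (mul_mem h₁.1 h₂.1) ?_
    rw [h₃.2, grClass_mul h₁.1 h₂.1, h₁.2, h₂.2])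

theorem grAd_grClass {q : ℕ} (a : FreePro S r) {w : FreePro S r}
    (hw : w ∈ lcs (FreePro S r) q) : grAd q a (grClass q w) = grClass (q + 1) ⁅a, w⁆ :=
  grClass_commutator_congr a (grClass_surjective (grClass q w)).choose_spec.1 hw
    (grClass_surjective (grClass q w)).choose_spec.2

theorem grClass_jacobi {p q : ℕ} (hq : 1 ≤ q) (a : FreePro S r) {b z : FreePro S r}
    (hb : b ∈ lcs (FreePro S r) p) (hz : z ∈ lcs (FreePro S r) q) :
    grClass (p + 1 + q) ⁅⁅a, b⁆, z⁆ =
      grClass (p + 1 + q) ⁅a, ⁅b, z⁆⁆ - grClass (p + 1 + q) ⁅b, ⁅a, z⁆⁆ := by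
  have hab := commutator_mem_lcs_succ a hb
  have haz := commutator_mem_lcs_succ a hz
  have hbz := commutator_mem_lcs hb hz le_rfl
  have h₁ := commutator_mem_lcs hab hz le_rfl
  have h₂ := commutator_mem_lcs (N := p + 1 + q) hb haz (by omega)
  have h₃ := commutator_mem_lcs (N := p + 1 + q) (mem_lcs_one a) hbz (by omega)
  rw [eq_sub_iff_add_eq, ← grClass_mul h₁ h₂, grClass_eq_iff (mul_mem h₁ h₂) h₃]
  let f := QuotientGroup.mk' (lcs (FreePro S r) (p + 1 + q + 1))
  have hf : ∀ u v : FreePro S r, ⁅u, v⁆ ∈ lcs (FreePro S r) (p + 1 + q + 1) →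
      Commute (f u) (f v) := fun u v h => by
    rw [← commutatorElement_eq_one_iff_commute, ← map_commutatorElement]
    exact (QuotientGroup.eq_one_iff _).2 h
  change f _ = f _
  simp only [map_mul, map_commutatorElement]
  apply commutatorElement_jacobi
  · rw [← map_mul, ← map_commutatorElement, ← map_commutatorElement]
    exact hf _ _ (commutator_mem_lcs hab (commutator_mem_lcs_succ (b * a) hz) (by omega))
  · rw [← map_commutatorElement, ← map_commutatorElement]
    exact hf _ _ (commutator_mem_lcs haz hbz (by omega))
  · intro w
    obtain ⟨w, rfl⟩ := QuotientGroup.mk'_surjective _ w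
    rw [← map_commutatorElement, ← map_commutatorElement]
    exact hf _ _ (commutator_mem_lcs h₁ (mem_lcs_one w) (by omega))

end Graded

/-! ### Iterated commutators and the Dynkin–Specht–Wever identity -/

section Dynkin

open scoped IsMulCommutative

variable {S : Set ℕ} {r : ℕ}

/-- The iterated commutator `[γ_{J(1)}, [γ_{J(2)}, …, [γ_{J(p)}, z]]]`. -/
def nestedComm : (p : ℕ) → (Fin p → Fin r) → FreePro S r → FreePro S r
  | 0, _, z => z
  | p + 1, J, z => ⁅(gen (J 0) : FreePro S r), nestedComm p (Fin.tail J) z⁆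

/-- The iterated commutator `[γ_{K(1)}, [γ_{K(2)}, …, γ_{K(p+1)}]]`. -/
def basicComm : (p : ℕ) → (Fin (p + 1) → Fin r) → FreePro S r
  | 0, K => gen (K 0)
  | p + 1, K => ⁅(gen (K 0) : FreePro S r), basicComm p (Fin.tail K)⁆

/-- The coefficient of the word `X_{J(1)} ⋯ X_{J(p+1)}` in the Lie polynomial
`[X_{K(1)}, [X_{K(2)}, …, X_{K(p+1)}]]`. -/
def lieCoeff : (p : ℕ) → (Fin (p + 1) → Fin r) → (Fin (p + 1) → Fin r) → ℤ
  | 0, K, J => if J 0 = K 0 then 1 else 0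
  | p + 1, K, J => (if J 0 = K 0 then lieCoeff p (Fin.tail K) (Fin.tail J) else 0) -
      if J (Fin.last (p + 1)) = K 0 then lieCoeff p (Fin.tail K) (Fin.init J) else 0

theorem nestedComm_snoc (p : ℕ) (J : Fin p → Fin r) (k : Fin r) (z : FreePro S r) :
    nestedComm (p + 1) (Fin.snoc J k) z = nestedComm p J ⁅(gen k : FreePro S r), z⁆ := by
  induction p with
  | zero => simp [nestedComm, Fin.snoc]
  | succ p ih =>
    rw [nestedComm.eq_def (p + 1 + 1), nestedComm.eq_def (p + 1)]
    simp only [← ih, Fin.tail_def]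
    congr 2
    funext i
    refine Fin.lastCases ?_ (fun i => ?_) i
    · rw [Fin.snoc_last, Fin.succ_last, Fin.snoc_last]
    · rw [Fin.snoc_castSucc, ← Fin.castSucc_succ, Fin.snoc_castSucc]

theorem basicComm_snoc (p : ℕ) (J : Fin p → Fin r) (k : Fin r) :
    basicComm (S := S) p (Fin.snoc J k) = nestedComm p J (gen k) := by
  induction p with
  | zero => simp [nestedComm, basicComm, Fin.snoc]
  | succ p ih =>
    rw [nestedComm, basicComm, ← ih, Fin.tail_def]
    congr 2
    funext i
    refine Fin.lastCases ?_ (fun i => ?_) i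
    · rw [Fin.snoc_last, Fin.succ_last, Fin.snoc_last]
    · rw [Fin.snoc_castSucc, ← Fin.castSucc_succ, Fin.snoc_castSucc]; rfl

theorem nestedComm_mem_lcs {q : ℕ} (p : ℕ) (J : Fin p → Fin r) {z : FreePro S r}
    (hz : z ∈ lcs (FreePro S r) q) : nestedComm p J z ∈ lcs (FreePro S r) (q + p) := by
  induction p with
  | zero => exact hz
  | succ p ih => exact commutator_mem_lcs_succ _ (ih _)

theorem basicComm_mem_lcs (p : ℕ) (K : Fin (p + 1) → Fin r) :
    basicComm p K ∈ lcs (FreePro S r) (p + 1) := by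
  induction p with
  | zero => exact mem_lcs_one _
  | succ p ih => exact commutator_mem_lcs_succ _ (ih _)

theorem sum_lieCoeff_succ {A : Type*} [AddCommGroup A] (p : ℕ) (K : Fin (p + 2) → Fin r)
    (f : (Fin (p + 2) → Fin r) → A) :
    ∑ J, lieCoeff (p + 1) K J • f J =
      (∑ J, lieCoeff p (Fin.tail K) J • f (Fin.cons (K 0) J : Fin (p + 2) → Fin r)) -
        ∑ J, lieCoeff p (Fin.tail K) J • f (Fin.snoc J (K 0) : Fin (p + 2) → Fin r) := by
  simp only [lieCoeff, sub_smul, Finset.sum_sub_distrib]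
  congr 1
  · rw [← (Fin.consEquiv fun _ => Fin r).sum_comp, Fintype.sum_prod_type,
      Finset.sum_eq_single (K 0)]
    · simp [Fin.consEquiv]
    · intro b _ hb
      simp [Fin.consEquiv, hb]
    · simp
  · rw [← (Fin.snocEquiv fun _ => Fin r).sum_comp, Fintype.sum_prod_type,
      Finset.sum_eq_single (K 0)]
    · simp [Fin.snocEquiv]
    · intro b _ hb
      simp [Fin.snocEquiv, hb]
    · simp

theorem grClass_basicComm_commutator (p q : ℕ) (hq : 1 ≤ q) (K : Fin (p + 1) → Fin r)
    {z : FreePro S r} (hz : z ∈ lcs (FreePro S r) q) :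
    grClass (q + (p + 1)) ⁅(basicComm p K : FreePro S r), z⁆ =
      ∑ J, lieCoeff p K J • grClass (q + (p + 1)) (nestedComm (p + 1) J z) := by
  induction p generalizing q z with
  | zero =>
    rw [Finset.sum_eq_single K]
    · simp [lieCoeff, nestedComm, basicComm]
    · intro J _ hJ
      have : J 0 ≠ K 0 := fun h => hJ (funext fun i => by rw [Fin.eq_zero i, h])
      simp [lieCoeff, this]
    · simp
  | succ p ih =>
    have hb := basicComm_mem_lcs (S := S) p (Fin.tail K)
    have h := grClass_jacobi hq (gen (K 0)) hb hz
    rw [show p + 1 + 1 + q = q + (p + 1) + 1 by omega] at h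
    have h₁ := commutator_mem_lcs (N := q + (p + 1)) hb hz (by omega)
    rw [basicComm]
    refine h.trans ?_
    rw [← grAd_grClass _ h₁, ih q hq _ hz, map_sum]
    have h₂ := ih (q + 1) (by omega) (Fin.tail K) (commutator_mem_lcs_succ (gen (K 0)) hz)
    rw [show q + 1 + (p + 1) = q + (p + 1) + 1 by omega] at h₂
    rw [h₂]
    refine Eq.trans ?_ (sum_lieCoeff_succ p K _).symm
    congr 1
    · refine Finset.sum_congr rfl fun J _ => ?_
      rw [map_zsmul, grAd_grClass _ (nestedComm_mem_lcs _ _ hz), nestedComm.eq_def (p + 1 + 1)]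
      simp only [Fin.cons_zero, Fin.tail_cons]
      rfl
    · refine Finset.sum_congr rfl fun J _ => ?_
      rw [nestedComm_snoc]
      rfl

/-- The Dynkin–Specht–Wever identity in `[π]_{p+1}/[π]_{p+2}`. -/
theorem dynkin_specht_wever (p : ℕ) (K : Fin (p + 1) → Fin r) :
    ∑ J, lieCoeff p K J • grClass (S := S) (p + 1) (basicComm p J) =
      (p + 1) • grClass (p + 1) (basicComm p K) := by
  induction p with
  | zero =>
    rw [Finset.sum_eq_single K]
    · simp [lieCoeff]
    · intro J _ hJ
      have : J 0 ≠ K 0 := fun h => hJ (funext fun i => by rw [Fin.eq_zero i, h])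
      simp [lieCoeff, this]
    · simp
  | succ p ih =>
    have hb := basicComm_mem_lcs (S := S) p (Fin.tail K)
    rw [sum_lieCoeff_succ]
    have h₁ : ∑ J, lieCoeff p (Fin.tail K) J • grClass (S := S) (p + 1 + 1)
        (basicComm (p + 1) (Fin.cons (K 0) J : Fin (p + 2) → Fin r)) =
        (p + 1) • grClass (p + 1 + 1) (basicComm (p + 1) K) := by
      rw [basicComm, ← grAd_grClass _ hb, ← map_nsmul, ← ih, map_sum]
      refine Finset.sum_congr rfl fun J _ => ?_
      rw [map_zsmul, grAd_grClass _ (basicComm_mem_lcs _ _), basicComm]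
      simp
    have h₂ := grClass_basicComm_commutator p 1 le_rfl (Fin.tail K)
      (mem_lcs_one (gen (K 0) : FreePro S r))
    rw [add_comm 1 (p + 1)] at h₂
    rw [h₁]
    simp only [basicComm_snoc]
    rw [← h₂, ← commutatorElement_inv, grClass_inv (commutator_mem_lcs_succ _ hb), sub_neg_eq_add,
      succ_nsmul _ (p + 1)]
    rfl

end Dynkin

/-! ### Density, and powers with exponents in `ℤ^S` -/

section Density

variable {S : Set ℕ} {F : Type*} [Group F]

theorem SigmaSubgroup.exists_le (I : Finset (SigmaSubgroup S F)) :
    ∃ M : SigmaSubgroup S F, ∀ N ∈ I, M.1 ≤ N.1 := by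
  classical
  induction I using Finset.induction_on with
  | empty =>
    refine ⟨⟨⊤, inferInstance, ?_⟩, by simp⟩
    rw [Subgroup.index_top]
    exact ⟨one_ne_zero, fun p hp h => absurd (Nat.dvd_one.1 h) hp.one_lt.ne'⟩
  | insert N I _ ih =>
    obtain ⟨M, hM⟩ := ih
    refine ⟨⟨N.1 ⊓ M.1, inferInstance, N.isSigma_inf M⟩, fun N' hN' => ?_⟩
    rcases Finset.mem_insert.1 hN' with rfl | h
    · exact inf_le_left
    · exact inf_le_right.trans (hM N' h)

theorem denseRange_toCompletion : DenseRange (toCompletion : F → proCompletion S F) := by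
  intro w
  rw [mem_closure_iff]
  intro o ho hw
  obtain ⟨o', ho', rfl⟩ := isOpen_induced_iff.1 ho
  obtain ⟨I, u, hu, hsub⟩ := isOpen_pi_iff.1 ho' w.1 hw
  obtain ⟨M, hM⟩ := SigmaSubgroup.exists_le I
  obtain ⟨y, hy⟩ := FinQuot.mk_surjective M (w.1 M)
  refine ⟨toCompletion y, hsub fun N hN => ?_, y, rfl⟩
  have : (toCompletion y : proCompletion S F).1 N = w.1 N := by
    rw [← w.2 M N (hM N hN), ← hy, FinQuot.map_mk]; rfl
  rw [this]
  exact (hu N hN).2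

theorem denseRange_natCast_ZSigma : DenseRange ((↑) : ℕ → ZSigma S) := by
  intro w
  rw [mem_closure_iff]
  intro o ho hw
  obtain ⟨o', ho', rfl⟩ := isOpen_induced_iff.1 ho
  obtain ⟨I, u, hu, hsub⟩ := isOpen_pi_iff.1 ho' w.1 hw
  have hk : IsSigmaNumber S (∏ m ∈ I, m.1) :=
    Finset.prod_induction _ _ (fun _ _ => IsSigmaNumber.mul)
      ⟨one_ne_zero, fun p hp h => absurd (Nat.dvd_one.1 h) hp.one_lt.ne'⟩ fun m _ => m.2
  obtain ⟨e, he, -⟩ := exists_nat_approx w ⟨_, hk⟩ ⟨_, hk⟩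
  refine ⟨(e : ZSigma S), hsub fun m hm => ?_, e, rfl⟩
  have : (e : ZSigma S).1 m = w.1 m := by
    rw [← w.2 m ⟨_, hk⟩ (Finset.dvd_prod_of_mem _ hm), ← he, map_natCast]; rfl
  rw [this]
  exact (hu m hm).2

theorem continuous_spow (w : proCompletion S F) : Continuous fun u : ZSigma S => spow w u := by
  refine Continuous.subtype_mk (continuous_pi fun N => ?_) _
  have h : Continuous fun a : ZMod N.1.index => w.1 N ^ a.val := continuous_of_discreteTopology
  exact h.comp ((continuous_apply (⟨N.1.index, N.2.2⟩ : {m : ℕ // IsSigmaNumber S m})).comp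
    continuous_subtype_val)

theorem spow_natCast (w : proCompletion S F) (e : ℕ) : spow w (e : ZSigma S) = w ^ e :=
  Subtype.ext (funext fun N => spow_apply w e N e rfl)

theorem spow_add (w : proCompletion S F) (u v : ZSigma S) :
    spow w (u + v) = spow w u * spow w v := by
  refine Subtype.ext (funext fun N => ?_)
  obtain ⟨e, he, -⟩ := exists_nat_approx u ⟨N.1.index, N.2.2⟩ ⟨N.1.index, N.2.2⟩
  obtain ⟨d, hd, -⟩ := exists_nat_approx v ⟨N.1.index, N.2.2⟩ ⟨N.1.index, N.2.2⟩
  change _ = (spow w u).1 N * (spow w v).1 N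
  rw [spow_apply w v N d hd, spow_apply w u N e he, ← pow_add, spow_apply w (u + v) N (e + d)]
  push_cast
  rw [he, hd]; rfl

theorem spow_mem {C : Subgroup (proCompletion S F)} (hC : IsClosed (C : Set (proCompletion S F)))
    {w : proCompletion S F} (hw : w ∈ C) (u : ZSigma S) : spow w u ∈ C :=
  denseRange_natCast_ZSigma.induction_on (p := fun u => spow w u ∈ C) u
    (hC.preimage (continuous_spow w)) fun e => by
      rw [spow_natCast]; exact pow_mem hw e

variable {r : ℕ}

theorem eq_top_of_gen_mem {C : Subgroup (FreePro S r)} (hC : IsClosed (C : Set (FreePro S r)))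
    (h : ∀ i, gen i ∈ C) : C = ⊤ := by
  refine (Subgroup.eq_top_iff' C).2 fun w => ?_
  refine denseRange_toCompletion.induction_on (p := fun w => w ∈ C) w hC fun y => ?_
  have : Subgroup.closure (Set.range FreeGroup.of) ≤ C.comap (toCompletion (S := S)) := by
    rw [Subgroup.closure_le]
    rintro _ ⟨i, rfl⟩
    exact h i
  rw [FreeGroup.closure_range_of] at this
  exact this (Subgroup.mem_top y)

/-- The group `[π]_{p+1}` is topologically generated by `[π]_{p+2}` and the iterated commutators
of the generators. -/
theorem lcs_le_of_basicComm_mem (p : ℕ) {M : Subgroup (FreePro S r)}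
    (hM : IsClosed (M : Set (FreePro S r))) (hb : ∀ K, basicComm p K ∈ M)
    (hs : lcs (FreePro S r) (p + 2) ≤ M) : lcs (FreePro S r) (p + 1) ≤ M := by
  induction p generalizing M with
  | zero => exact (eq_top_of_gen_mem hM fun i => hb fun _ => i).ge
  | succ p ih =>
    refine Subgroup.topologicalClosure_minimal _ ?_ hM
    have hmul : ∀ {a b : FreePro S r}, b ∈ lcs (FreePro S r) (p + 2) → ⁅a, b⁆ ∈ M := fun hb =>
      hs (commutator_mem_lcs_succ _ hb)
    have hgen : ∀ (k : Fin r), ∀ w ∈ lcs (FreePro S r) (p + 1),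
        ⁅(gen k : FreePro S r), w⁆ ∈ M := by
      intro k
      let C : Subgroup (FreePro S r) :=
        { carrier := {w | w ∈ lcs (FreePro S r) (p + 1) ∧ ⁅(gen k : FreePro S r), w⁆ ∈ M}
          one_mem' := ⟨one_mem _, by rw [commutatorElement_one_right]; exact one_mem _⟩
          mul_mem' := fun {w v} hw hv => ⟨mul_mem hw.1 hv.1, by
            have e : ⁅(gen k : FreePro S r), w * v⁆ = ⁅(gen k : FreePro S r), w⁆ *
                ⁅w, ⁅(gen k : FreePro S r), v⁆⁆ * ⁅(gen k : FreePro S r), v⁆ := by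
              simp only [commutatorElement_def]; group
            rw [e]
            exact mul_mem (mul_mem hw.2 (hmul (commutator_mem_lcs_succ _ hv.1))) hv.2⟩
          inv_mem' := fun {w} hw => ⟨inv_mem hw.1, by
            have e : ⁅(gen k : FreePro S r), w⁻¹⁆ =
                ⁅w⁻¹, ⁅(gen k : FreePro S r), w⁆⁻¹⁆ * ⁅(gen k : FreePro S r), w⁆⁻¹ := by
              simp only [commutatorElement_def]; group
            rw [e]
            exact mul_mem (hmul (inv_mem (commutator_mem_lcs_succ _ hw.1))) (inv_mem hw.2)⟩ }
      have hC : lcs (FreePro S r) (p + 1) ≤ C := by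
        refine ih ?_ (fun K => ⟨basicComm_mem_lcs p K, ?_⟩)
          fun w hw => ⟨lcs_succ_le _ hw, hmul hw⟩
        · have hc : Continuous fun w : FreePro S r => ⁅(gen k : FreePro S r), w⁆ := by
            simp only [commutatorElement_def]
            fun_prop
          exact (isClosed_lcs (p + 1)).inter (hM.preimage hc)
        · have h := hb (Fin.cons k K)
          rwa [basicComm, Fin.cons_zero, Fin.tail_cons] at h
      exact fun w hw => (hC hw).2
    rw [Subgroup.commutator_le]
    intro a _ w hw
    let C : Subgroup (FreePro S r) :=
      { carrier := {a | ⁅a, w⁆ ∈ M}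
        one_mem' := by rw [Set.mem_ofPred_eq, commutatorElement_one_left]; exact one_mem _
        mul_mem' := fun {a b} ha hb => by
          have e : ⁅a * b, w⁆ = ⁅a, ⁅b, w⁆⁆ * ⁅b, w⁆ * ⁅a, w⁆ := by
            simp only [commutatorElement_def]; group
          rw [Set.mem_ofPred_eq, e]
          exact mul_mem (mul_mem (hmul (commutator_mem_lcs_succ _ hw)) hb) ha
        inv_mem' := fun {a} ha => by
          have e : ⁅a⁻¹, w⁆ = ⁅a⁻¹, ⁅a, w⁆⁻¹⁆ * ⁅a, w⁆⁻¹ := by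
            simp only [commutatorElement_def]; group
          rw [Set.mem_ofPred_eq, e]
          exact mul_mem (hmul (inv_mem (commutator_mem_lcs_succ _ hw))) (inv_mem ha) }
    have hC : C = ⊤ := by
      have hc : Continuous fun a : FreePro S r => ⁅a, w⁆ := by
        simp only [commutatorElement_def]
        fun_prop
      exact eq_top_of_gen_mem (hM.preimage hc) fun i => hgen i w hw
    exact hC.ge (Subgroup.mem_top a)

end Density

/-! ### Entries of unipotent matrices -/

section Entries

variable {R : Type*} [CommRing R] {n : ℕ}

theorem Unip.entry_self (i : Fin (n + 1)) (A : Unip R n) : Unip.entry i i A = 1 :=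
  (A.2 i i le_rfl).trans (Matrix.one_apply_eq i)

theorem Unip.entry_of_lt {i j : Fin (n + 1)} (h : j < i) (A : Unip R n) :
    Unip.entry i j A = 0 :=
  (A.2 i j h.le).trans (Matrix.one_apply_ne (ne_of_gt h : i ≠ j))

/-- The endomorphism of `U_{n+1}` that multiplies the `(i,j)`-entry by `u^{j-i}`. -/
noncomputable def Unip.dilate (u : R) : Unip R n →* Unip R n :=
  MonoidHom.mk' (fun A => Unip.ofMatrix (fun i j => u ^ ((j : ℕ) - i) * Unip.entry i j A)
    fun i j hij => by
      rw [Nat.sub_eq_zero_of_le hij, pow_zero, one_mul]; exact A.2 i j hij) fun A B => by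
    refine Unip.ext_entry fun i j => ?_
    rw [Unip.entry_mul]
    change u ^ ((j : ℕ) - i) * Unip.entry i j (A * B) =
      ∑ p : Fin (n + 1), (u ^ ((p : ℕ) - i) * Unip.entry i p A) * (u ^ ((j : ℕ) - p) * Unip.entry p j B)
    rw [Unip.entry_mul, Finset.mul_sum]
    refine Finset.sum_congr rfl fun p _ => ?_
    rcases lt_or_ge p i with h | h
    · rw [Unip.entry_of_lt h]; ring
    rcases lt_or_ge j p with h' | h'
    · rw [Unip.entry_of_lt h']; ring
    have h₁ : (i : ℕ) ≤ p := h
    have h₂ : (p : ℕ) ≤ j := h'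
    rw [show (j : ℕ) - i = ((p : ℕ) - i) + (j - p) by omega, pow_add]
    ring

theorem Unip.entry_dilate (u : R) (A : Unip R n) (i j : Fin (n + 1)) :
    Unip.entry i j (Unip.dilate u A) = u ^ ((j : ℕ) - i) * Unip.entry i j A := rfl

/-- The leading entries of a commutator. -/
theorem Unip.entry_commutator {k : ℕ} (A : Unip R n) {B : Unip R n}
    (hB : B ∈ Unip.filt (R := R) (n := n) k) (hk : 1 ≤ k) {i i' j' j : Fin (n + 1)}
    (hi : (i' : ℕ) = i + 1) (hj' : (j' : ℕ) = i + k) (hj : (j : ℕ) = i + k + 1) :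
    Unip.entry i j ⁅A, B⁆ =
      Unip.entry i i' A * Unip.entry i' j B - Unip.entry i j' B * Unip.entry j' j A := by
  have hB : StrictUpper k (B.1.1 - 1) := hB
  have hA := Unip.strictUpper A
  set X := A.1.1 - 1 with hX
  set Y := B.1.1 - 1 with hY
  have e : ⁅A, B⁆.1.1 = (X * Y - Y * X) * (A⁻¹ * B⁻¹).1.1 + 1 := by
    have h1 : X * Y - Y * X = A.1.1 * B.1.1 - B.1.1 * A.1.1 := by rw [hX, hY]; noncomm_ring
    have h2 : B.1.1 * A.1.1 * (A⁻¹ * B⁻¹).1.1 = 1 := by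
      change (B.1 * A.1 * (A.1⁻¹ * B.1⁻¹)).1 = 1
      rw [mul_assoc, mul_inv_cancel_left, mul_inv_cancel, Units.val_one]
    rw [h1, sub_mul, h2, sub_add_cancel]
    change (A.1 * B.1 * A.1⁻¹ * B.1⁻¹).1 = (A.1 * B.1 * (A.1⁻¹ * B.1⁻¹)).1
    rw [mul_assoc (A.1 * B.1)]
  have hZ : StrictUpper (k + 1) (X * Y - Y * X) :=
    StrictUpper.sub (by simpa [add_comm] using hA.mul hB) (hB.mul hA)
  have off : ∀ {s t : Fin (n + 1)} (C : Unip R n), (s : ℕ) < t →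
      (C.1.1 - 1) s t = Unip.entry s t C := fun {s t} C h => by
    rw [Matrix.sub_apply, Matrix.one_apply_ne (fun e => by subst e; omega), sub_zero]; rfl
  have hij : i ≠ j := fun e => by subst e; omega
  rw [Unip.entry, e, Matrix.add_apply, Matrix.one_apply_ne hij, add_zero, Matrix.mul_apply,
    Finset.sum_eq_single j]
  · have hV : (A⁻¹ * B⁻¹).1.1 j j = 1 := Unip.entry_self j _
    rw [hV, mul_one, Matrix.sub_apply, Matrix.mul_apply, Matrix.mul_apply,
      Finset.sum_eq_single i', Finset.sum_eq_single j', hX, hY,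
      off (s := i) (t := i') A (by omega), off (s := i') (t := j) B (by omega),
      off (s := j') (t := j) A (by omega), off (s := i) (t := j') B (by omega)]
    · intro p _ hp
      have hp' : (p : ℕ) ≠ j' := fun h => hp (Fin.ext h)
      by_cases h : (p : ℕ) < i + k
      · rw [hB i p h, zero_mul]
      · rw [hA p j (by omega), mul_zero]
    · simp
    · intro p _ hp
      have hp' : (p : ℕ) ≠ i' := fun h => hp (Fin.ext h)
      by_cases h : (p : ℕ) < i + 1
      · rw [hA i p h, zero_mul]
      · rw [hB p j (by omega), mul_zero]
    · simp
  · intro p _ hp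
    have hp' : (p : ℕ) ≠ j := fun h => hp (Fin.ext h)
    by_cases h : (p : ℕ) < i + (k + 1)
    · rw [hZ i p h, zero_mul]
    · have : (A⁻¹ * B⁻¹).1.1 p j = 0 := Unip.entry_of_lt (Fin.lt_def.2 (by omega)) _
      rw [this, mul_zero]
  · simp

open Classical in
theorem entry_expMatrix {r : ℕ} (J : Fin n → Fin r) (k : Fin r) (i j : Fin (n + 1)) :
    Unip.entry i j (expMatrix J k : Unip R n) =
      if i ≤ j ∧ ∀ v : Fin n, (i : ℕ) ≤ v → (v : ℕ) < j → J v = k then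
        Ring.inverse ((Nat.factorial ((j : ℕ) - i) : ℕ) : R) else 0 := by
  change (if i < j ∧ ∀ v : Fin n, (i : ℕ) ≤ v → (v : ℕ) < j → J v = k then
      Ring.inverse ((Nat.factorial ((j : ℕ) - i) : ℕ) : R)
    else if i = j then 1 else 0) = _
  rcases eq_or_ne i j with rfl | h
  · have : ∀ v : Fin n, (i : ℕ) ≤ v → (v : ℕ) < i → J v = k := fun v h h' => by omega
    rw [if_neg (fun h => lt_irrefl _ h.1), if_pos rfl, if_pos ⟨le_rfl, this⟩]
    simp
  · rw [if_neg h]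
    simp only [h.le_iff_lt]

theorem entry_expMatrix_succ {r : ℕ} (J : Fin n → Fin r) (k : Fin r) (v : Fin n)
    {i j : Fin (n + 1)} (hi : (i : ℕ) = v) (hj : (j : ℕ) = v + 1) :
    Unip.entry i j (expMatrix J k : Unip R n) = if J v = k then 1 else 0 := by
  classical
  rw [entry_expMatrix]
  refine if_congr ⟨fun h => h.2 v hi.le (by omega), fun h => ⟨Fin.le_def.2 (by omega), ?_⟩⟩ ?_ rfl
  · intro v' h1 h2
    rw [← h]
    congr 1
    exact Fin.ext (by omega)
  · rw [show (j : ℕ) - i = 1 by omega]; simp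

theorem sum_inverse_factorial (u : R) (m : ℕ) (hm : ∀ l ≤ m, IsUnit ((Nat.factorial l : ℕ) : R)) :
    ∑ t ∈ Finset.range (m + 1), u ^ t * Ring.inverse ((Nat.factorial t : ℕ) : R) *
      Ring.inverse ((Nat.factorial (m - t) : ℕ) : R) =
      (u + 1) ^ m * Ring.inverse ((Nat.factorial m : ℕ) : R) := by
  rw [add_pow, Finset.sum_mul]
  refine Finset.sum_congr rfl fun t ht => ?_
  have ht : t ≤ m := Nat.le_of_lt_succ (Finset.mem_range.1 ht)
  have h₁ := hm t ht
  have h₂ := hm (m - t) (Nat.sub_le _ _)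
  have h₃ := hm m le_rfl
  have h : ((Nat.choose m t : ℕ) : R) * (Nat.factorial t : ℕ) * (Nat.factorial (m - t) : ℕ) =
      (Nat.factorial m : ℕ) := by
    rw [← Nat.choose_mul_factorial_mul_factorial ht]; push_cast; ring
  have e₁ := Ring.inverse_mul_cancel _ h₁
  have e₂ := Ring.inverse_mul_cancel _ h₂
  have e₃ := Ring.inverse_mul_cancel _ h₃
  rw [one_pow, mul_one, mul_assoc, mul_assoc]
  congr 1
  refine (h₁.mul h₂).mul_left_cancel ?_
  generalize Ring.inverse ((Nat.factorial t : ℕ) : R) = a at *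
  generalize Ring.inverse ((Nat.factorial (m - t) : ℕ) : R) = b at *
  generalize Ring.inverse ((Nat.factorial m : ℕ) : R) = c at *
  linear_combination (b * (Nat.factorial (m - t) : ℕ)) * e₁ + e₂ - e₃ - c * h

theorem dilate_expMatrix_mul (hfac : ∀ l ≤ n, IsUnit ((Nat.factorial l : ℕ) : R)) {r : ℕ}
    (J : Fin n → Fin r) (k : Fin r) (u : R) :
    Unip.dilate u (expMatrix J k) * expMatrix J k = Unip.dilate (u + 1) (expMatrix J k) := by
  classical
  refine Unip.ext_entry fun i j => ?_
  rw [Unip.entry_mul]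
  simp only [Unip.entry_dilate]
  by_cases h : i ≤ j ∧ ∀ v : Fin n, (i : ℕ) ≤ v → (v : ℕ) < j → J v = k
  · have hij : (i : ℕ) ≤ j := h.1
    have hj : (j : ℕ) < n + 1 := j.2
    have key : ∀ p : Fin (n + 1), u ^ ((p : ℕ) - i) * Unip.entry i p (expMatrix J k : Unip R n) *
        Unip.entry p j (expMatrix J k : Unip R n) =
        (fun x : ℕ => if (i : ℕ) ≤ x ∧ x < j + 1 then u ^ (x - i) *
          Ring.inverse ((Nat.factorial (x - i) : ℕ) : R) *
          Ring.inverse ((Nat.factorial (j - x) : ℕ) : R) else 0) p := by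
      intro p
      beta_reduce
      rw [entry_expMatrix, entry_expMatrix]
      by_cases hp : (i : ℕ) ≤ p ∧ (p : ℕ) < j + 1
      · rw [if_pos hp, if_pos ⟨Fin.le_def.2 hp.1, fun v hv hv' => h.2 v hv (by omega)⟩,
          if_pos ⟨Fin.le_def.2 (by omega), fun v hv hv' => h.2 v (by omega) hv'⟩]
      · rw [if_neg hp]
        by_cases h₁ : i ≤ p
        · rw [if_neg (c := p ≤ j ∧ _) fun h₂ => hp ⟨h₁, Nat.lt_succ_of_le h₂.1⟩, mul_zero]
        · rw [if_neg (c := i ≤ p ∧ _) fun h₂ => h₁ h₂.1, mul_zero, zero_mul]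
    rw [Finset.sum_congr rfl fun p _ => key p, Fin.sum_univ_eq_sum_range (fun x : ℕ =>
      if (i : ℕ) ≤ x ∧ x < j + 1 then u ^ (x - i) *
        Ring.inverse ((Nat.factorial (x - i) : ℕ) : R) *
        Ring.inverse ((Nat.factorial (j - x) : ℕ) : R) else 0), ← Finset.sum_filter]
    have hf : (Finset.range (n + 1)).filter (fun x => (i : ℕ) ≤ x ∧ x < j + 1) =
        Finset.Ico (i : ℕ) (j + 1) := by
      ext x
      simp only [Finset.mem_filter, Finset.mem_range, Finset.mem_Ico]
      omega
    rw [hf, Finset.sum_Ico_eq_sum_range, entry_expMatrix, if_pos h, ← sum_inverse_factorial u _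
      fun l hl => hfac l (by omega)]
    rw [show (j : ℕ) + 1 - i = j - i + 1 by omega]
    refine Finset.sum_congr rfl fun t _ => ?_
    rw [Nat.add_sub_cancel_left, Nat.sub_sub]
  · rw [entry_expMatrix _ _ i j, if_neg h, mul_zero]
    refine Finset.sum_eq_zero fun p _ => ?_
    rw [entry_expMatrix, entry_expMatrix]
    split_ifs with h₁ h₂
    · refine absurd ⟨h₁.1.trans h₂.1, fun v hv hv' => ?_⟩ h
      rcases lt_or_ge (v : ℕ) p with hp | hp
      · exact h₁.2 v hv hp
      · exact h₂.2 v hp hv'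
    all_goals ring

theorem expMatrix_pow (hfac : ∀ l ≤ n, IsUnit ((Nat.factorial l : ℕ) : R)) {r : ℕ}
    (J : Fin n → Fin r) (k : Fin r) (e : ℕ) :
    (expMatrix J k : Unip R n) ^ e = Unip.dilate (e : R) (expMatrix J k) := by
  induction e with
  | zero =>
    refine Unip.ext_entry fun i j => ?_
    rw [pow_zero, Unip.entry_dilate, Nat.cast_zero]
    rcases lt_trichotomy i j with h | rfl | h
    · have h' : (i : ℕ) < j := h
      rw [zero_pow (by omega), zero_mul]
      exact Matrix.one_apply_ne h.ne
    · rw [Nat.sub_self, pow_zero, one_mul, Unip.entry_self, Unip.entry_self]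
    · rw [Unip.entry_of_lt h, Unip.entry_of_lt h, mul_zero]
  | succ e ih => rw [pow_succ, ih, dilate_expMatrix_mul hfac, Nat.cast_succ]

end Entries

/-! ### The homomorphisms `φ_J` -/

section Phi

variable {S : Set ℕ} {r n : ℕ}

theorem phi_spow_gen (hfac : ∀ l ≤ n, IsUnit ((Nat.factorial l : ℕ) : ZSigma S))
    (J : Fin n → Fin r) (k : Fin r) (u : ZSigma S) :
    phi J (spow (gen k) u) = Unip.dilate u (phi J (gen k)) := by
  refine Unip.ext_entry fun i j => ?_
  rw [Unip.entry_dilate]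
  refine denseRange_natCast_ZSigma.induction_on (p := fun u => Unip.entry i j
    (phi J (spow (gen k) u)) = u ^ ((j : ℕ) - i) * Unip.entry i j (phi J (gen k))) u
    (isClosed_eq ((continuous_entry_phi J i j).comp (continuous_spow _)) (by fun_prop)) fun e => ?_
  rw [spow_natCast, map_pow, phi_gen, expMatrix_pow hfac, Unip.entry_dilate]

theorem continuous_powEnd_right (u : ZSigma S) :
    Continuous fun w : FreePro S r => powEnd S r u w :=
  Continuous.uncurry_left (f := fun u w => powEnd S r u w) u (continuous_powEnd r)

theorem phi_powEnd (hfac : ∀ l ≤ n, IsUnit ((Nat.factorial l : ℕ) : ZSigma S))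
    (J : Fin n → Fin r) (u : ZSigma S) (w : FreePro S r) :
    phi J (powEnd S r u w) = Unip.dilate u (phi J w) := by
  have hF : (phi J).comp ((powEnd S r u : FreePro S r →* FreePro S r).comp toCompletion) =
      (Unip.dilate u).comp ((phi J).comp toCompletion) := by
    refine FreeGroup.ext_hom _ _ fun k => ?_
    have h := phi_spow_gen hfac J k u
    rw [← powEnd_gen] at h
    exact h
  have hF' : ∀ y, phi J (powEnd S r u (toCompletion y)) =
      Unip.dilate u (phi J (toCompletion y)) := DFunLike.congr_fun hF
  refine Unip.ext_entry fun i j => ?_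
  rw [Unip.entry_dilate]
  refine denseRange_toCompletion.induction_on (p := fun w => Unip.entry i j
    (phi J (powEnd S r u w)) = u ^ ((j : ℕ) - i) * Unip.entry i j (phi J w)) w
    (isClosed_eq ?_ (continuous_const.mul (continuous_entry_phi J i j))) fun y => ?_
  · exact (continuous_entry_phi J i j).comp (continuous_powEnd_right u)
  · rw [← Unip.entry_dilate, hF']

theorem Unip.entry_succ_mul {R : Type*} [CommRing R] (v : Fin n) (A B : Unip R n) :
    Unip.entry v.castSucc v.succ (A * B) =
      Unip.entry v.castSucc v.succ A + Unip.entry v.castSucc v.succ B := by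
  have hne : v.castSucc ≠ v.succ := Fin.castSucc_lt_succ.ne
  rw [Unip.entry_mul, Finset.sum_eq_add v.castSucc v.succ hne]
  · rw [Unip.entry_self, Unip.entry_self, one_mul, mul_one, add_comm]
  · intro p _ hp
    rcases lt_or_gt_of_ne hp.1 with h | h
    · rw [Unip.entry_of_lt h, zero_mul]
    · rw [Unip.entry_of_lt (lt_of_le_of_ne (Fin.castSucc_lt_iff_succ_le.1 h) hp.2.symm), mul_zero]
  · simp
  · simp

theorem coord_gen (i k : Fin r) :
    (coord i (gen k : FreePro S r)).toAdd = if k = i then (1 : ZSigma S) else 0 := by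
  rw [coord, gen, SigmaLimit.ext_toCompletion, FreeGroup.lift_apply_of]; rfl

theorem entry_phi_succ (J : Fin n → Fin r) (v : Fin n) (w : FreePro S r) :
    Unip.entry v.castSucc v.succ (phi J w) = (coord (J v) w).toAdd := by
  let f : FreePro S r →* Multiplicative (ZSigma S) :=
    MonoidHom.mk' (fun w => Multiplicative.ofAdd (Unip.entry v.castSucc v.succ (phi J w)))
      fun a b => by rw [map_mul, Unip.entry_succ_mul]; rfl
  have h : MonoidHom.eqLocus f (coord (J v)) = ⊤ := by
    refine eq_top_of_gen_mem ?_ fun k => ?_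
    · have : IsClosed {w : FreePro S r | Unip.entry v.castSucc v.succ (phi J w) =
          (coord (J v) w).toAdd} :=
        isClosed_eq (continuous_entry_phi J _ _) (continuous_coord (J v))
      exact this
    · refine Multiplicative.toAdd.injective ?_
      change Unip.entry v.castSucc v.succ (phi J (gen k)) = _
      rw [phi_gen, entry_expMatrix_succ J k v rfl rfl, coord_gen]
      simp only [eq_comm]
  exact congrArg Multiplicative.toAdd (h.ge (Subgroup.mem_top w))

theorem phi_mem_filt (J : Fin n → Fin r) {k : ℕ} {w : FreePro S r}
    (hw : w ∈ lcs (FreePro S r) k) : phi J w ∈ Unip.filt (R := ZSigma S) (n := n) k :=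
  lcs_le_comap_phi J k hw

theorem entry_phi_basicComm (J : Fin n → Fin r) (p : ℕ) (K : Fin (p + 1) → Fin r) (s : ℕ)
    (hs : s + p < n) :
    Unip.entry (⟨s, by omega⟩ : Fin (n + 1)) ⟨s + p + 1, by omega⟩
        (phi J (basicComm p K : FreePro S r)) =
      ((lieCoeff p K fun t => J ⟨s + t, by omega⟩ : ℤ) : ZSigma S) := by
  induction p generalizing s with
  | zero =>
    rw [basicComm, phi_gen, entry_expMatrix_succ J _ ⟨s, hs⟩ rfl rfl, lieCoeff]
    simp
  | succ p ih =>
    rw [basicComm, map_commutatorElement,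
      Unip.entry_commutator (k := p + 1) _ (phi_mem_filt J (basicComm_mem_lcs p _)) (by omega)
        (i' := ⟨s + 1, by omega⟩) (j' := ⟨s + p + 1, by omega⟩) rfl
        (show s + p + 1 = s + (p + 1) by omega) (show s + (p + 1) + 1 = s + (p + 1) + 1 by omega),
      ih _ s (by omega), phi_gen, entry_expMatrix_succ J _ ⟨s, by omega⟩ rfl rfl,
      entry_expMatrix_succ J _ ⟨s + p + 1, by omega⟩ rfl (by simp; omega)]
    have h := ih (Fin.tail K) (s + 1) (by omega)
    have e : (⟨s + 1 + p + 1, by omega⟩ : Fin (n + 1)) = ⟨s + (p + 1) + 1, by omega⟩ :=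
      Fin.ext (by simp; omega)
    rw [e] at h
    rw [h, lieCoeff]
    have e₁ : Fin.tail (fun t : Fin (p + 2) => J ⟨s + t, by omega⟩) =
        fun t : Fin (p + 1) => J ⟨s + 1 + t, by omega⟩ := funext fun t => by
      simp only [Fin.tail, Fin.val_succ]
      congr 2
      omega
    have e₂ : Fin.init (fun t : Fin (p + 2) => J ⟨s + t, by omega⟩) =
        fun t : Fin (p + 1) => J ⟨s + t, by omega⟩ := rfl
    rw [e₁, e₂]
    push_cast
    simp only [ite_mul, mul_ite, one_mul, mul_one, zero_mul, mul_zero, Fin.val_zero, add_zero,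
      add_assoc]

end Phi

/-! ### The splitting of `[π]_n/[π]_{n+1} → ⊕_J ℤ^S` -/

section Corner

variable {R : Type*} [CommRing R] {n : ℕ}

theorem Unip.entry_mul_of_lt {i j : Fin (n + 1)} (hij : i < j) (A B : Unip R n) :
    Unip.entry i j (A * B) = Unip.entry i j B +
      ∑ p ∈ Finset.Ioo i j, Unip.entry i p A * Unip.entry p j B + Unip.entry i j A := by
  rw [Unip.entry_mul, ← Finset.sum_subset (Finset.subset_univ (Finset.Icc i j)),
    ← Finset.Ioc_insert_left hij.le, Finset.sum_insert (by simp),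
    ← Finset.Ioo_insert_right hij, Finset.sum_insert (by simp), Unip.entry_self,
    Unip.entry_self]
  · ring
  · intro p _ hp
    rw [Finset.mem_Icc, not_and_or, not_le, not_le] at hp
    rcases hp with hp | hp
    · rw [Unip.entry_of_lt hp, zero_mul]
    · rw [Unip.entry_of_lt hp, mul_zero]

theorem Unip.eq_one_of_mem_filt {A : Unip R n} (hA : A ∈ Unip.filt (R := R) (n := n) (n + 1)) :
    A = 1 :=
  Unip.ext_entry fun i j => sub_eq_zero.1 (hA i j (by omega))

theorem Unip.entry_corner_mul (hn : 0 < n) {A : Unip R n}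
    (hA : A ∈ Unip.filt (R := R) (n := n) n) (B : Unip R n) :
    Unip.entry 0 (Fin.last n) (A * B) =
      Unip.entry 0 (Fin.last n) A + Unip.entry 0 (Fin.last n) B := by
  rw [Unip.mem_filt_iff] at hA
  rw [Unip.entry_mul_of_lt (Fin.lt_def.2 (by simpa using hn)), Finset.sum_eq_zero]
  · ring
  · intro p hp
    rw [Finset.mem_Ioo] at hp
    rw [hA 0 p hp.1 fun e => hp.2.ne (Prod.mk.inj e).2, zero_mul]

end Corner

section Splitting

open scoped IsMulCommutative

variable {S : Set ℕ} {r n : ℕ}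

/-- The homomorphism `π/[π]_{n+1} → U_{n+1}` induced by `φ_J`. -/
noncomputable def phiQuot (J : Fin n → Fin r) : LcsQuot S r (n + 1) →* Unip (ZSigma S) n :=
  QuotientGroup.lift _ (phi J) fun _ hw => Unip.eq_one_of_mem_filt (phi_mem_filt J hw)

theorem phiQuot_mk (J : Fin n → Fin r) (w : FreePro S r) :
    phiQuot J (w : LcsQuot S r (n + 1)) = phi J w := rfl

theorem continuous_entry_phiQuot (J : Fin n → Fin r) (i j : Fin (n + 1)) :
    Continuous fun q : LcsQuot S r (n + 1) => Unip.entry i j (phiQuot J q) :=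
  QuotientGroup.isOpenQuotientMap_mk.continuous_comp_iff.1 (continuous_entry_phi J i j)

theorem phiQuot_mem_filt (J : Fin n → Fin r) (k : gradedPiece S r n) :
    phiQuot J (k : LcsQuot S r (n + 1)) ∈ Unip.filt (R := ZSigma S) (n := n) n := by
  obtain ⟨w, hw, h⟩ := k.2
  rw [← h]
  exact phi_mem_filt J hw

/-- The corner entry of `φ_J` as a homomorphism from `[π]_n/[π]_{n+1}` to `ℤ^S`. -/
noncomputable def cornerHom (hn : 0 < n) (J : Fin n → Fin r) :
    Additive (gradedPiece S r n) →+ ZSigma S :=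
  AddMonoidHom.mk' (fun k => Unip.entry 0 (Fin.last n) (phiQuot J k.toMul.1)) fun k l => by
    rw [← Unip.entry_corner_mul hn (phiQuot_mem_filt J k.toMul), ← map_mul]; rfl

theorem cornerHom_apply (hn : 0 < n) (J : Fin n → Fin r) (k : Additive (gradedPiece S r n)) :
    cornerHom hn J k = Unip.entry 0 (Fin.last n) (phiQuot J k.toMul.1) := rfl

theorem cornerHom_grClass (hn : 0 < n) (J : Fin n → Fin r) {w : FreePro S r}
    (hw : w ∈ lcs (FreePro S r) n) :
    cornerHom hn J (grClass n w) = Unip.entry 0 (Fin.last n) (phi J w) := by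
  rw [cornerHom_apply, coe_grClass hw, phiQuot_mk]

theorem continuous_cornerHom (hn : 0 < n) (J : Fin n → Fin r) :
    Continuous (cornerHom (S := S) hn J) :=
  (continuous_entry_phiQuot J 0 (Fin.last n)).comp
    (continuous_subtype_val.comp continuous_toMul)

theorem grClass_eq_zero_iff {N : ℕ} {w : FreePro S r} (hw : w ∈ lcs (FreePro S r) N) :
    grClass N w = 0 ↔ w ∈ lcs (FreePro S r) (N + 1) := by
  refine ⟨fun h => ?_, grClass_of_mem_succ⟩
  rw [← QuotientGroup.eq_one_iff, ← coe_grClass hw, h]; rfl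

theorem eq_zero_of_nsmul_eq_zero {N m : ℕ} (hm : IsUnit (m : ZSigma S))
    {k : Additive (gradedPiece S r N)} (hk : m • k = 0) : k = 0 := by
  obtain ⟨w, hw, rfl⟩ := grClass_surjective k
  rw [← grClass_pow hw, grClass_eq_zero_iff (pow_mem hw m), ← spow_natCast] at hk
  rw [grClass_eq_zero_iff hw]
  have h := spow_mem (isClosed_lcs (N + 1)) hk (Ring.inverse (m : ZSigma S))
  rwa [← spow_mul, Ring.mul_inverse_cancel _ hm, spow_one] at h

/-- The homomorphism `u ↦ w^u` from `ℤ^S` to `[π]_N/[π]_{N+1}`, for `w ∈ [π]_N`. -/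
noncomputable def grPow {N : ℕ} {w : FreePro S r} (hw : w ∈ lcs (FreePro S r) N) :
    ZSigma S →+ Additive (gradedPiece S r N) :=
  AddMonoidHom.mk' (fun u => grClass N (spow w u)) fun u v => by
    rw [spow_add, grClass_mul (spow_mem (isClosed_lcs N) hw u) (spow_mem (isClosed_lcs N) hw v)]

theorem grPow_apply {N : ℕ} {w : FreePro S r} (hw : w ∈ lcs (FreePro S r) N) (u : ZSigma S) :
    grPow hw u = grClass N (spow w u) := rfl

theorem continuous_grPow {N : ℕ} {w : FreePro S r} (hw : w ∈ lcs (FreePro S r) N) :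
    Continuous (grPow hw) := by
  have h : (grPow hw : ZSigma S → Additive (gradedPiece S r N)) = fun u => Additive.ofMul
      ⟨(spow w u : LcsQuot S r (N + 1)), spow w u, spow_mem (isClosed_lcs N) hw u, rfl⟩ :=
    funext fun u => dif_pos (spow_mem (isClosed_lcs N) hw u)
  rw [h]
  exact continuous_ofMul.comp
    (Continuous.subtype_mk (continuous_quotient_mk'.comp (continuous_spow w)) _)

theorem cornerHom_grPow (hn : 0 < n) (J : Fin n → Fin r) {w : FreePro S r}
    (hw : w ∈ lcs (FreePro S r) n) (u : ZSigma S) :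
    cornerHom hn J (grPow hw u) = u * cornerHom hn J (grClass n w) := by
  refine denseRange_natCast_ZSigma.induction_on
    (p := fun u => cornerHom hn J (grPow hw u) = u * cornerHom hn J (grClass n w)) u
    (isClosed_eq ((continuous_cornerHom hn J).comp (continuous_grPow hw))
      (continuous_id.mul continuous_const)) fun e => ?_
  rw [grPow_apply, spow_natCast, grClass_pow hw, map_nsmul, nsmul_eq_mul]

variable {p : ℕ}

theorem cornerHom_basicComm (J K : Fin (p + 1) → Fin r) :
    cornerHom p.succ_pos J (grClass (p + 1) (basicComm p K)) =
      ((lieCoeff p K J : ℤ) : ZSigma S) := by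
  rw [cornerHom_grClass _ _ (basicComm_mem_lcs p K)]
  have h := entry_phi_basicComm (S := S) J p K 0 (by omega)
  have e : (fun t : Fin (p + 1) => J ⟨0 + t, by omega⟩) = J :=
    funext fun t => congrArg J (Fin.ext (Nat.zero_add _))
  rw [e] at h
  rw [← h]
  congr 1
  exact Fin.ext (by simp)

variable (S r p) in
/-- The map `(e_J)_J ↦ (p+1)⁻¹ ∑_J e_J [γ_{J(1)}, [γ_{J(2)}, …, γ_{J(p+1)}]]`. -/
noncomputable def grSplit :
    ((Fin (p + 1) → Fin r) → ZSigma S) →+ Additive (gradedPiece S r (p + 1)) :=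
  ∑ J, ((grPow (basicComm_mem_lcs p J)).comp
    (AddMonoidHom.mulLeft (Ring.inverse ((p + 1 : ℕ) : ZSigma S)))).comp
      (Pi.evalAddMonoidHom (fun _ => ZSigma S) J)

theorem grSplit_apply (e : (Fin (p + 1) → Fin r) → ZSigma S) :
    grSplit S r p e = ∑ J, grPow (basicComm_mem_lcs p J)
      (Ring.inverse ((p + 1 : ℕ) : ZSigma S) * e J) := by
  rw [grSplit, AddMonoidHom.finsetSum_apply]; rfl

theorem continuous_grSplit : Continuous (grSplit S r p) := by
  have h : ⇑(grSplit S r p) = fun e : (Fin (p + 1) → Fin r) → ZSigma S =>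
      ∑ J : Fin (p + 1) → Fin r, grPow (basicComm_mem_lcs (S := S) p J)
        (Ring.inverse ((p + 1 : ℕ) : ZSigma S) * e J) := funext grSplit_apply
  rw [h]
  exact continuous_finsetSum _ fun J _ =>
    (continuous_grPow _).comp (continuous_const.mul (continuous_apply J))

theorem cornerHom_grSplit_mul (J : Fin (p + 1) → Fin r) (u : ZSigma S)
    (e : (Fin (p + 1) → Fin r) → ZSigma S) :
    cornerHom p.succ_pos J (grSplit S r p fun K => u * e K) =
      u * cornerHom p.succ_pos J (grSplit S r p e) := by
  rw [grSplit_apply, grSplit_apply, map_sum, map_sum, Finset.mul_sum]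
  refine Finset.sum_congr rfl fun K _ => ?_
  rw [cornerHom_grPow, cornerHom_grPow]
  ring

theorem grSplit_cornerHom_basicComm (hp : IsUnit ((p + 1 : ℕ) : ZSigma S))
    (K : Fin (p + 1) → Fin r) :
    grSplit S r p (fun J => cornerHom p.succ_pos J (grClass (p + 1) (basicComm p K))) =
      grClass (p + 1) (basicComm p K) := by
  rw [← sub_eq_zero]
  refine eq_zero_of_nsmul_eq_zero hp ?_
  rw [smul_sub, ← dynkin_specht_wever, sub_eq_zero, grSplit_apply, Finset.smul_sum]
  refine Finset.sum_congr rfl fun J _ => ?_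
  rw [← map_nsmul, nsmul_eq_mul, ← mul_assoc, Ring.mul_inverse_cancel _ hp, one_mul,
    cornerHom_basicComm, ← zsmul_one, map_zsmul, grPow_apply, spow_one]

/-- The corner entries of the `φ_J` split `[π]_{p+1}/[π]_{p+2}` off from `⊕_J ℤ^S`. -/
theorem grSplit_cornerHom (hp : IsUnit ((p + 1 : ℕ) : ZSigma S))
    (k : Additive (gradedPiece S r (p + 1))) :
    grSplit S r p (fun J => cornerHom p.succ_pos J k) = k := by
  let f : Additive (gradedPiece S r (p + 1)) →+ Additive (gradedPiece S r (p + 1)) :=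
    (grSplit S r p).comp (AddMonoidHom.mk' (fun k J => cornerHom p.succ_pos J k)
      fun k l => funext fun J => map_add _ k l)
  have hf : ∀ k, f k = grSplit S r p (fun J => cornerHom p.succ_pos J k) := fun _ => rfl
  let M : Subgroup (FreePro S r) :=
    { carrier := {w | w ∈ lcs (FreePro S r) (p + 1) ∧
        f (grClass (p + 1) w) = grClass (p + 1) w}
      one_mem' := ⟨one_mem _, by rw [grClass_of_mem_succ (one_mem _), map_zero]⟩
      mul_mem' := fun {w v} hw hv => ⟨mul_mem hw.1 hv.1, by
        rw [grClass_mul hw.1 hv.1, map_add, hw.2, hv.2]⟩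
      inv_mem' := fun {w} hw => ⟨inv_mem hw.1, by rw [grClass_inv hw.1, map_neg, hw.2]⟩ }
  have hM : IsClosed (M : Set (FreePro S r)) := by
    have hT : T2Space (LcsQuot S r (p + 1 + 1)) := by
      have := isClosed_lcs (P := FreePro S r) (p + 1 + 1)
      infer_instance
    have hset : (M : Set (FreePro S r)) = (lcs (FreePro S r) (p + 1) : Set (FreePro S r)) ∩
        {w | ((grSplit S r p fun J => Unip.entry 0 (Fin.last (p + 1)) (phi J w)).toMul :
          LcsQuot S r (p + 1 + 1)) = w} := by
      ext w
      refine and_congr_right fun hw => ?_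
      have e : (fun J => Unip.entry 0 (Fin.last (p + 1)) (phi J w)) =
          fun J => cornerHom p.succ_pos J (grClass (p + 1) w) :=
        funext fun J => (cornerHom_grClass p.succ_pos J hw).symm
      rw [Set.mem_ofPred_eq, e, ← coe_grClass hw, SetLike.coe_eq_coe, Equiv.apply_eq_iff_eq, hf]
    rw [hset]
    refine (isClosed_lcs (p + 1)).inter (isClosed_eq ?_ continuous_quotient_mk')
    exact continuous_subtype_val.comp (continuous_toMul.comp
      (continuous_grSplit.comp (continuous_pi fun J => continuous_entry_phi J _ _)))
  have hle : lcs (FreePro S r) (p + 1) ≤ M := by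
    refine lcs_le_of_basicComm_mem p hM (fun K => ⟨basicComm_mem_lcs p K, ?_⟩)
      fun w hw => ⟨lcs_succ_le _ hw, ?_⟩
    · exact grSplit_cornerHom_basicComm hp K
    · rw [grClass_of_mem_succ hw, map_zero]
  obtain ⟨w, hw, rfl⟩ := grClass_surjective k
  exact (hle hw).2

end Splitting

/-! ### Equivariance -/

section Equivariance

open scoped IsMulCommutative

variable {S : Set ℕ} {r n p : ℕ} {G : Type*} [Group G] [TopologicalSpace G]

theorem phiQuot_quotAct (hfac : ∀ l ≤ n, IsUnit ((Nat.factorial l : ℕ) : ZSigma S))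
    (χ : G →ₜ* (ZSigma S)ˣ) (J : Fin n → Fin r) (g : G) (q : LcsQuot S r (n + 1)) :
    phiQuot J (quotAct r χ (n + 1) g q) = Unip.dilate (χ g : ZSigma S) (phiQuot J q) := by
  obtain ⟨w, rfl⟩ := QuotientGroup.mk_surjective q
  rw [quotAct_mk, phiQuot_mk, phiQuot_mk]
  exact phi_powEnd hfac J _ w

theorem cornerHom_coeff (hfac : ∀ l ≤ n, IsUnit ((Nat.factorial l : ℕ) : ZSigma S)) (hn : 0 < n)
    (χ : G →ₜ* (ZSigma S)ˣ) (J : Fin n → Fin r) (g : G) (k : Additive (gradedPiece S r n)) :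
    cornerHom hn J ((lcsExt r χ n).coeff g k) = (χ g : ZSigma S) ^ n * cornerHom hn J k := by
  rw [cornerHom_apply, CentralExt.coe_coeff, phiQuot_quotAct hfac, Unip.entry_dilate]
  simp [cornerHom_apply]

theorem coeff_grSplit (hfac : ∀ l ≤ p + 1, IsUnit ((Nat.factorial l : ℕ) : ZSigma S))
    (hp : IsUnit ((p + 1 : ℕ) : ZSigma S)) (χ : G →ₜ* (ZSigma S)ˣ) (g : G)
    (e : (Fin (p + 1) → Fin r) → ZSigma S) :
    (lcsExt r χ (p + 1)).coeff g (grSplit S r p e) =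
      grSplit S r p fun J => (χ g : ZSigma S) ^ (p + 1) * e J := by
  rw [← grSplit_cornerHom hp ((lcsExt r χ (p + 1)).coeff g _),
    ← grSplit_cornerHom hp (grSplit S r p fun J => (χ g : ZSigma S) ^ (p + 1) * e J)]
  congr 1
  funext J
  rw [cornerHom_coeff hfac, cornerHom_grSplit_mul]

/-- The entries of `φ_J` on `π/[π]_n`, evaluated on a product of the kind that occurs in the
cocycle condition. -/
theorem entry_phiBar_mul_quotAct (hfac : ∀ l ≤ n, IsUnit ((Nat.factorial l : ℕ) : ZSigma S))
    (χ : G →ₜ* (ZSigma S)ˣ) (J : Fin n → Fin r) {i j : Fin (n + 1)} (hij : i < j)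
    (hne : (i, j) ≠ (0, Fin.last n)) (g : G) (q q' : LcsQuot S r n) :
    UnipBar.entry i j (phiBar J (q * quotAct r χ n g q')) =
      (χ g : ZSigma S) ^ ((j : ℕ) - i) * UnipBar.entry i j (phiBar J q') +
        ∑ p ∈ Finset.Ioo i j, UnipBar.entry i p (phiBar J q) *
          ((χ g : ZSigma S) ^ ((j : ℕ) - p) * UnipBar.entry p j (phiBar J q')) +
        UnipBar.entry i j (phiBar J q) := by
  obtain ⟨w, rfl⟩ := QuotientGroup.mk_surjective q
  obtain ⟨v, rfl⟩ := QuotientGroup.mk_surjective q'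
  have hmk : ∀ {s t : Fin (n + 1)} (_ : (s, t) ≠ (0, Fin.last n)) (z : FreePro S r),
      UnipBar.entry s t (phiBar J (z : LcsQuot S r n)) = Unip.entry s t (phi J z) :=
    fun h z => UnipBar.entry_mk h (phi J z)
  rw [quotAct_mk, ← QuotientGroup.mk_mul, hmk hne, hmk hne, hmk hne, map_mul,
    Unip.entry_mul_of_lt hij, show phi J (act r χ g v) = Unip.dilate (χ g : ZSigma S) (phi J v) from
      phi_powEnd hfac J _ v]
  simp only [Unip.entry_dilate]
  congr 2
  refine Finset.sum_congr rfl fun p hp => ?_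
  rw [Finset.mem_Ioo] at hp
  rw [hmk fun e => (hp.2.trans_le (Fin.le_last j)).ne (Prod.mk.inj e).2,
    hmk fun e => ((Fin.zero_le i).trans_lt hp.1).ne' (Prod.mk.inj e).1]

theorem entry_phiBar_succ (J : Fin n → Fin r) (hn : 2 ≤ n) (v : Fin n)
    (hv : (v.castSucc, v.succ) ≠ (0, Fin.last n)) (q : LcsQuot S r n) :
    UnipBar.entry v.castSucc v.succ (phiBar J q) = (coordAb (J v) (lcsProj S r hn q)).toAdd := by
  obtain ⟨w, rfl⟩ := QuotientGroup.mk_surjective q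
  exact (UnipBar.entry_mk hv (phi J w)).trans (entry_phi_succ J v w)

theorem entry_phiBar_lcsProj (J : Fin n → Fin r) {i j : Fin (n + 1)}
    (hne : (i, j) ≠ (0, Fin.last n)) (q : LcsQuot S r (n + 1)) :
    UnipBar.entry i j (phiBar J (lcsProj S r (Nat.le_succ n) q)) =
      Unip.entry i j (phiQuot J q) := by
  obtain ⟨w, rfl⟩ := QuotientGroup.mk_surjective q
  exact UnipBar.entry_mk hne (phi J w)

theorem isDefiningSystem_phiSystem (hfac : ∀ l ≤ n, IsUnit ((Nat.factorial l : ℕ) : ZSigma S))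
    (χ : G →ₜ* (ZSigma S)ˣ) (x : Cocycle (quotAct r χ n)) (J : Fin n → Fin r) :
    IsDefiningSystem χ (fun i => -abClass χ x (J i)) (phiSystem χ x J) := by
  refine ⟨fun v hv => ?_, fun i j hij hne => ?_⟩
  · have hn : 2 ≤ n := by
      by_contra h
      have := v.2
      refine hv (Prod.ext (Fin.ext ?_) (Fin.ext ?_)) <;>
        simp only [Fin.val_castSucc, Fin.val_zero, Fin.val_succ, Fin.val_last] <;> omega
    have e : phiSystem χ x J v.castSucc v.succ = (-abCocycle χ hn x (J v)).1 :=
      ContinuousMap.ext fun g => congrArg Neg.neg (entry_phiBar_succ J hn v hv (x.1 g))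
    have hz : phiSystem χ x J v.castSucc v.succ ∈ Z1 (twist χ 1) :=
      e ▸ (-abCocycle χ hn x (J v)).2
    refine ⟨hz, ?_⟩
    change _ = -abClass χ x (J v)
    rw [show (⟨_, hz⟩ : Z1 (twist χ 1)) = -abCocycle χ hn x (J v) from Subtype.ext e, map_neg,
      abClass, dif_pos hn]
  · refine funext fun ⟨g, h⟩ => ?_
    have hij' : i < j := Fin.lt_def.2 (by omega)
    have key := entry_phiBar_mul_quotAct hfac χ J hij' hne g (x.1 g) (x.1 h)
    rw [← x.2] at key
    simp only [dOne, cup, twist_apply, Finset.sum_apply, phiSystem, ContinuousMap.coe_mk, key,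
      mul_neg, neg_mul, neg_neg]
    ring

variable [IsTopologicalGroup G]

/-- The corner entry of `φ_J` sends the cochain that defines `δ_n([x])` to the Massey product
cochain, up to a coboundary. -/
theorem cornerHom_liftCochain (hfac : ∀ l ≤ n, IsUnit ((Nat.factorial l : ℕ) : ZSigma S))
    (hn : 0 < n) (χ : G →ₜ* (ZSigma S)ˣ) (x : Cocycle (quotAct r χ n)) (J : Fin n → Fin r)
    (y : C(G, LcsQuot S r (n + 1))) (hy : ∀ g, (lcsExt r χ n).proj (y g) = x.1 g) (g h : G) :
    cornerHom hn J ((lcsExt r χ n).liftCochain hy (g, h)) =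
      dOne (twist χ n) (fun g => Unip.entry 0 (Fin.last n) (phiQuot J (y g))) (g, h) +
        masseyCochain χ (phiSystem χ x J) (g, h) := by
  have hlt : (0 : Fin (n + 1)) < Fin.last n := Fin.lt_def.2 (by simpa using hn)
  set c := (lcsExt r χ n).liftCochain hy (g, h) with hc
  have e : (c.toMul : LcsQuot S r (n + 1)) * y (g * h) =
      y g * quotAct r χ (n + 1) g (y h) := by
    rw [hc, CentralExt.coe_liftCochain, inv_mul_cancel_right]
  have e' := congrArg (fun q => Unip.entry 0 (Fin.last n) (phiQuot J q)) e
  simp only [map_mul] at e'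
  rw [Unip.entry_corner_mul hn (phiQuot_mem_filt J c.toMul), phiQuot_quotAct hfac,
    Unip.entry_mul_of_lt hlt] at e'
  simp only [Unip.entry_dilate, Fin.val_last, Fin.val_zero, Nat.sub_zero] at e'
  have hm : masseyCochain χ (phiSystem χ x J) (g, h) =
      ∑ p ∈ Finset.Ioo 0 (Fin.last n), Unip.entry 0 p (phiQuot J (y g)) *
        ((χ g : ZSigma S) ^ (n - (p : ℕ)) * Unip.entry p (Fin.last n) (phiQuot J (y h))) := by
    simp only [masseyCochain, ContinuousMap.coe_mk, Finset.sum_apply, cup, twist_apply, phiSystem]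
    refine Finset.sum_congr rfl fun p hp => ?_
    rw [Finset.mem_Ioo] at hp
    rw [← hy g, ← hy h]
    have h₁ := entry_phiBar_lcsProj J (i := 0) (j := p)
      (fun e => hp.2.ne (Prod.mk.inj e).2) (y g)
    have h₂ := entry_phiBar_lcsProj J (i := p) (j := Fin.last n)
      (fun e => hp.1.ne' (Prod.mk.inj e).1) (y h)
    change -UnipBar.entry 0 p (phiBar J (lcsProj S r (Nat.le_succ n) (y g))) *
      (_ * -UnipBar.entry p (Fin.last n) (phiBar J (lcsProj S r (Nat.le_succ n) (y h)))) = _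
    rw [h₁, h₂]
    ring
  rw [hm, cornerHom_apply, dOne, twist_apply]
  linear_combination e'

theorem H2.mk_eq_zero_iff {G : Type*} [Group G] [TopologicalSpace G] {A : Type*} [AddCommGroup A]
    [TopologicalSpace A] [IsTopologicalAddGroup A] {ρ : G →* AddMonoid.End A} (c : Z2 ρ) :
    H2.mk c = 0 ↔ ∃ b : C(G, A), ∀ g h, c.1 (g, h) = dOne ρ b (g, h) := by
  refine (QuotientAddGroup.eq_zero_iff c).trans (AddSubgroup.mem_addSubgroupOf.trans ?_)
  exact exists_congr fun b => ⟨fun h g g' => congrFun h (g, g'), fun h => funext fun p => h p.1 p.2⟩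

theorem deltaN_eq_zero_iff (hfac : ∀ l ≤ n, IsUnit ((Nat.factorial l : ℕ) : ZSigma S))
    (hn : 0 < n) (χ : G →ₜ* (ZSigma S)ˣ) (x : Cocycle (quotAct r χ n))
    (hT : ∀ J : Fin n → Fin r,
      IsDefiningSystem χ (fun i => -abClass χ x (J i)) (phiSystem χ x J)) :
    deltaN r χ n (NonabH1.mk x) = 0 ↔ ∀ J : Fin n → Fin r, massey (hT J) = 0 := by
  obtain ⟨y, hy⟩ := (lcsExt r χ n).exists_lift x
  have hb : ∀ J : Fin n → Fin r, Continuous fun g =>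
      Unip.entry 0 (Fin.last n) (phiQuot J (y g)) := fun J =>
    (continuous_entry_phiQuot J _ _).comp y.continuous
  have key := cornerHom_liftCochain hfac hn χ x (hy := hy)
  rw [deltaN, CentralExt.delta_mk _ x y hy, H2.mk_eq_zero_iff]
  simp only [massey, H2.mk_eq_zero_iff]
  constructor
  · rintro ⟨b, hδ⟩ J
    refine ⟨⟨fun g => cornerHom hn J (b g), (continuous_cornerHom hn J).comp b.continuous⟩ -
      ⟨_, hb J⟩, fun g h => ?_⟩
    have h₁ := key J g h
    have h₂ := congrArg (cornerHom hn J) (hδ g h)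
    simp only [dOne, map_add, map_sub, cornerHom_coeff hfac] at h₂
    rw [h₂] at h₁
    simp only [dOne, twist_apply, ContinuousMap.sub_apply, ContinuousMap.coe_mk] at h₁ ⊢
    linear_combination -h₁
  · intro hm
    choose β hβ using hm
    obtain ⟨p, rfl⟩ : ∃ p, n = p + 1 := ⟨n - 1, by omega⟩
    have hp : IsUnit ((p + 1 : ℕ) : ZSigma S) := by
      have h := hfac (p + 1) le_rfl
      rw [Nat.factorial_succ, Nat.cast_mul] at h
      exact isUnit_of_mul_isUnit_left h
    let e : G → (Fin (p + 1) → Fin r) → ZSigma S := fun g J =>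
      β J g + Unip.entry 0 (Fin.last (p + 1)) (phiQuot J (y g))
    have he : Continuous e := continuous_pi fun J => (β J).continuous.add (hb J)
    refine ⟨⟨fun g => grSplit _ r p (e g), continuous_grSplit.comp he⟩, fun g h => ?_⟩
    refine (grSplit_cornerHom hp _).symm.trans ?_
    simp only [dOne, ContinuousMap.coe_mk]
    rw [coeff_grSplit hfac hp, ← map_sub, ← map_add]
    congr 1
    funext J
    have h₁ := key J g h
    have h₂ := hβ J g h
    rw [h₂] at h₁
    refine h₁.trans ?_
    simp only [dOne, twist_apply, Pi.add_apply, Pi.sub_apply, e]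
    ring

end Equivariance

end DeltaMassey

theorem proposition2 (n : ℕ) (hn : 0 < n) (r : ℕ)
    {G : Type*} [Group G] [TopologicalSpace G] [IsTopologicalGroup G] [CompactSpace G]
    [TotallyDisconnectedSpace G]
    (χ : G →ₜ* (ZSigma (primesNotDvdFactorial n))ˣ) (x : Cocycle (quotAct r χ n)) :
    ∃ hT : ∀ J : Fin n → Fin r,
        IsDefiningSystem χ (fun i => -abClass χ x (J i)) (phiSystem χ x J),
      (deltaN r χ n (NonabH1.mk x) = 0 ↔ ∀ J : Fin n → Fin r, massey (hT J) = 0) := by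
  have hfac : ∀ l ≤ n, IsUnit ((Nat.factorial l : ℕ) : ZSigma (primesNotDvdFactorial n)) :=
    fun l hl => isUnit_factorial hl
  exact ⟨isDefiningSystem_phiSystem hfac χ x, deltaN_eq_zero_iff hfac hn χ x _⟩
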